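/- Let $\mathbb{k}$ be a field and let $V$ be a collection of $\mathbb{k}$-vector spaces $V(n)$, $n\ge 1$, with a fixed basis $B=\bigsqcup_{n\ge1}B(n)$. Let $\mathcal F_V$ be the free shuffle operad generated by $V$. It has a basis of tree monomials: rooted trees whose vertices with $n$ inputs are decorated by elements of $B(n)$, whose leaves are labelled bijectively by the elements of a finite nonempty ordered set ($\{1,\dots,N\}$ in arity $N$), and which are drawn in the plane so that the inputs of each vertex are ordered by the smallest leaf that can be reached from them. Fix an admissible ordering, that is, a well-order on the tree monomials of each arity such that replacing the operations in a shuffle composition of tree monomials by larger ones of the same arities increases the result. The leading term of a nonzero element of $\mathcal F_V(N)$ is the largest tree monomial that occurs in it with a nonzero coefficient. A tree monomial $\alpha$ is divisible by $\beta$ if $\alpha$ has a subtree $T'$ that becomes equal to $\beta$ when each leaf of $T'$ is labelled by the smallest leaf of $\alpha$ that can be reached from it and these labels are then renumbered in an order-preserving way. A Gröbner basis of an operadic ideal $M\subset\mathcal F_V$ is a set $G$ of elements that generates the ideal $M$ and is such that the leading term of every nonzero element of $M$ is divisible by the leading term of some nonzero element of $G$; a tree monomial is normal if it is not divisible by the leading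 term of any nonzero element of $G$. A tree monomial is prime if it has at least one vertex and its root is the only vertex $v$ for which the labels of the leaves that can be reached from $v$ form an interval in the ordered set of all leaves. **Theorem.** Let $\mathcal O=\mathcal F_V/(R)$ be a shuffle operad, where $(R)$ is the operadic ideal generated by a set $R$ of elements, and suppose that $(R)$ has a Gröbner basis $G$ such that the leading terms of all nonzero elements of $G$ are prime. Then $\mathcal O$, considered as a nonsymmetric operad (keeping only the compositions along nondecreasing surjections), is free, and it is freely generated by the classes of the prime normal tree monomials: for every nonsymmetric operad $\mathcal Q$ over $\mathbb{k}$ and every choice of an element $f(p)\in\mathcal Q(n)$ for each prime normal tree monomial $p$ of each arity $n$, there is exactly one morphism of nonsymmetric operads $\mathcal O\to\mathcal Q$ that sends the class of $p$ to $f(p)$ for all $p$. -/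

import Mathlib

universe u v w w'

/-! ### Operads, with components indexed by finite sets of natural numbers

The category of nonempty finite ordered sets and order-preserving bijections is equivalent to its
full subcategory of nonempty finite subsets of `ℕ`, so collections are indexed by the latter; the
component on the empty set is zero by convention. -/

/-- All elements of `A` are smaller than all elements of `B`. -/
def AllLT (A B : Finset ℕ) : Prop := ∀ a ∈ A, ∀ b ∈ B, a < b

/-- The least element of `A` is smaller than all elements of `B` (that is, for nonempty sets,
`min A < min B`). -/
def MinLT (A B : Finset ℕ) : Prop := ∃ a ∈ A, ∀ b ∈ B, a < b

/-- `Blocks R J K I` says that the sets `K j`, for `j ∈ J`, are the fibres of a surjection `I → J`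
such that `R (f⁻¹ j) (f⁻¹ j')` holds whenever `j < j'`. For `R = AllLT` these are the
nondecreasing surjections, for `R = MinLT` the shuffling surjections. -/
structure Blocks (R : Finset ℕ → Finset ℕ → Prop) (J : Finset ℕ) (K : {j // j ∈ J} → Finset ℕ)
    (I : Finset ℕ) : Prop where
  nonempty : ∀ j, (K j).Nonempty
  disjoint : ∀ j j', j ≠ j' → Disjoint (K j) (K j')
  mem_iff : ∀ i, i ∈ I ↔ ∃ j, i ∈ K j
  order : ∀ j j', j < j' → R (K j) (K j')

theorem Blocks.minLT {J : Finset ℕ} {K : {j // j ∈ J} → Finset ℕ} {I : Finset ℕ}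
    (h : Blocks AllLT J K I) : Blocks MinLT J K I where
  nonempty := h.nonempty
  disjoint := h.disjoint
  mem_iff := h.mem_iff
  order j j' hj := by
    obtain ⟨a, ha⟩ := h.nonempty j
    exact ⟨a, ha, fun b hb => h.order j j' hj a ha b hb⟩

/-- A monoid in the category of collections of `k`-vector spaces for the composition
`(P ∘ Q)(I) = ⨁ P(J) ⊗ ⨂_{j ∈ J} Q(f⁻¹ j)`, the sum being over the surjections `f : I → J` of the
type prescribed by `R`, up to order-preserving relabelling of `J`. The order-preserving bijections
act by composition with units, and the axioms below imply that this action is functorial and that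
all structure maps are natural. -/
structure BlockOperad (R : Finset ℕ → Finset ℕ → Prop) (k : Type u) [Field k] where
  obj : Finset ℕ → Type v
  [addCommGroup : ∀ I, AddCommGroup (obj I)]
  [module : ∀ I, Module k (obj I)]
  subsingleton_empty : Subsingleton (obj ∅)
  unit : ∀ x : ℕ, obj {x}
  comp : ∀ {J : Finset ℕ} {K : {j // j ∈ J} → Finset ℕ} {I : Finset ℕ}, Blocks R J K I →
    (obj J →ₗ[k] MultilinearMap k (fun j : {j // j ∈ J} => obj (K j)) (obj I))
  unit_comp : ∀ {x : ℕ} {I : Finset ℕ} (h : Blocks R {x} (fun _ => I) I) (a : obj I),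
    comp h (unit x) (fun _ => a) = a
  comp_unit : ∀ {J : Finset ℕ} (h : Blocks R J (fun j => {j.1}) J) (a : obj J),
    comp h a (fun j => unit j.1) = a
  assoc : ∀ {L J I : Finset ℕ} {G : {l // l ∈ L} → Finset ℕ} {K : {j // j ∈ J} → Finset ℕ}
    {M : {l // l ∈ L} → Finset ℕ} (hG : Blocks R L G J) (hK : Blocks R J K I)
    (hM : Blocks R L M I) (hsub : ∀ l, ∀ j ∈ G l, j ∈ J)
    (hGM : ∀ l, Blocks R (G l) (fun j => K ⟨j.1, hsub l j.1 j.2⟩) (M l))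
    (a : obj L) (b : ∀ l, obj (G l)) (c : ∀ j, obj (K j)),
    comp hK (comp hG a b) c =
      comp hM a (fun l => comp (hGM l) (b l) (fun j => c ⟨j.1, hsub l j.1 j.2⟩))

attribute [instance] BlockOperad.addCommGroup BlockOperad.module

/-- Shuffle operads over `k`. -/
abbrev ShuffleOperad (k : Type u) [Field k] := BlockOperad.{u, v} MinLT k

/-- Nonsymmetric operads over `k`. -/
abbrev NSOperad (k : Type u) [Field k] := BlockOperad.{u, v} AllLT k

/-- Morphisms of operads. -/
structure BlockOperad.Hom {R : Finset ℕ → Finset ℕ → Prop} {k : Type u} [Field k]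
    (P : BlockOperad.{u, v} R k) (Q : BlockOperad.{u, w} R k) where
  map : ∀ I, P.obj I →ₗ[k] Q.obj I
  map_unit : ∀ x, map {x} (P.unit x) = Q.unit x
  map_comp : ∀ {J : Finset ℕ} {K : {j // j ∈ J} → Finset ℕ} {I : Finset ℕ} (h : Blocks R J K I)
    (a : P.obj J) (c : ∀ j, P.obj (K j)),
    map I (P.comp h a c) = Q.comp h (map J a) (fun j => map (K j) (c j))

/-- The nonsymmetric operad underlying a shuffle operad: the same spaces and units, and only the
compositions along nondecreasing surjections. -/
def ShuffleOperad.toNS {k : Type u} [Field k] (P : ShuffleOperad.{u, v} k) : NSOperad.{u, v} k where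
  obj := P.obj
  subsingleton_empty := P.subsingleton_empty
  unit := P.unit
  comp h := P.comp h.minLT
  unit_comp h := P.unit_comp h.minLT
  comp_unit h := P.comp_unit h.minLT
  assoc hG hK hM hsub hGM := P.assoc hG.minLT hK.minLT hM.minLT hsub fun l => (hGM l).minLT

/-- The nonsymmetric operad `P` is freely generated by the family of elements
`ι x ∈ P(ar x) = P({0, …, ar x - 1})`. -/
def NSOperad.IsFreelyGenerated {k : Type u} [Field k] (P : NSOperad.{u, v} k) {X : Type w'}
    (ar : X → ℕ) (ι : ∀ x, P.obj (Finset.range (ar x))) : Prop :=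
  ∀ (Q : NSOperad.{u, w} k) (f : ∀ x, Q.obj (Finset.range (ar x))),
    ∃! φ : P.Hom Q, ∀ x, φ.map _ (ι x) = f x

/-! ### Ideals and quotients of shuffle operads -/

/-- Operadic ideals of a shuffle operad. -/
structure ShuffleOperad.Ideal {k : Type u} [Field k] (P : ShuffleOperad.{u, v} k) where
  carrier : ∀ I, Submodule k (P.obj I)
  comp_left : ∀ {J : Finset ℕ} {K : {j // j ∈ J} → Finset ℕ} {I : Finset ℕ}
    (h : Blocks MinLT J K I) (a : P.obj J) (c : ∀ j, P.obj (K j)),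
    a ∈ carrier J → P.comp h a c ∈ carrier I
  comp_right : ∀ {J : Finset ℕ} {K : {j // j ∈ J} → Finset ℕ} {I : Finset ℕ}
    (h : Blocks MinLT J K I) (a : P.obj J) (c : ∀ j, P.obj (K j)) (j : {j // j ∈ J}),
    c j ∈ carrier (K j) → P.comp h a c ∈ carrier I

/-- The ideal generated by a set of elements: the intersection of all ideals containing it. -/
def ShuffleOperad.idealSpan {k : Type u} [Field k] (P : ShuffleOperad.{u, v} k)
    (S : ∀ I, Set (P.obj I)) : P.Ideal where
  carrier I := ⨅ N : {N : P.Ideal // ∀ I, S I ⊆ N.carrier I}, N.1.carrier I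
  comp_left h a c ha := by
    rw [Submodule.mem_iInf] at ha ⊢
    exact fun N => N.1.comp_left h a c (ha N)
  comp_right h a c j hj := by
    rw [Submodule.mem_iInf] at hj ⊢
    exact fun N => N.1.comp_right h a c j (hj N)

section QuotientLift

variable {k : Type u} [Field k] {ι : Type} [Fintype ι] {V : ι → Type v}
  [∀ i, AddCommGroup (V i)] [∀ i, Module k (V i)] {N : Type w} [AddCommGroup N] [Module k N]

theorem multilinear_congr_mod (W : ∀ i, Submodule k (V i)) (f : MultilinearMap k V N)
    (hf : ∀ c i, c i ∈ W i → f c = 0) (c c' : ∀ i, V i) (h : ∀ i, c i - c' i ∈ W i) :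
    f c = f c' := by
  classical
  have key : ∀ s : Finset ι, f (fun i => if i ∈ s then c i else c' i) = f c' := by
    intro s
    induction s using Finset.induction_on with
    | empty => simp
    | insert a s ha ih =>
      rw [← ih, ← sub_eq_zero]
      have e1 : (fun i => if i ∈ insert a s then c i else c' i)
          = Function.update (fun i => if i ∈ s then c i else c' i) a (c a) := by
        funext i
        by_cases hi : i = a
        · subst hi; simp
        · simp [hi]
      have e2 : (fun i => if i ∈ s then c i else c' i)
          = Function.update (fun i => if i ∈ s then c i else c' i) a (c' a) := by
        funext i
        by_cases hi : i = a
        · subst hi; simp [ha]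
        · simp [hi]
      rw [e1]
      conv_lhs => rw [e2]
      rw [Function.update_idem, ← MultilinearMap.map_update_sub]
      exact hf _ a (by simpa using h a)
  simpa using key Finset.univ

/-- A multilinear map that vanishes as soon as one argument lies in `W i` descends to the
quotients. -/
noncomputable def multilinearQuotLift (W : ∀ i, Submodule k (V i)) (f : MultilinearMap k V N)
    (hf : ∀ c i, c i ∈ W i → f c = 0) : MultilinearMap k (fun i => V i ⧸ W i) N where
  toFun x := f fun i => (Submodule.Quotient.mk_surjective (W i) (x i)).choose
  map_update_add' := by
    intro _ m i x y
    have hc : ∀ z : ∀ i, V i ⧸ W i, ∀ i,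
        Submodule.Quotient.mk (Submodule.Quotient.mk_surjective (W i) (z i)).choose = z i :=
      fun z i => (Submodule.Quotient.mk_surjective (W i) (z i)).choose_spec
    obtain ⟨x, rfl⟩ := Submodule.Quotient.mk_surjective _ x
    obtain ⟨y, rfl⟩ := Submodule.Quotient.mk_surjective _ y
    let c : ∀ i, V i := fun i => (Submodule.Quotient.mk_surjective (W i) (m i)).choose
    have e : ∀ v : V i, f (fun i' => (Submodule.Quotient.mk_surjective (W i')
        (Function.update m i (Submodule.Quotient.mk v) i')).choose)
        = f (Function.update c i v) := by
      intro v
      refine multilinear_congr_mod W f hf _ _ fun i' => ?_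
      rw [← Submodule.Quotient.eq, hc]
      by_cases h : i' = i
      · subst h; simp
      · simp [h, c, hc]
    rw [← Submodule.Quotient.mk_add, e, e, e, f.map_update_add]
  map_update_smul' := by
    intro _ m i r x
    have hc : ∀ z : ∀ i, V i ⧸ W i, ∀ i,
        Submodule.Quotient.mk (Submodule.Quotient.mk_surjective (W i) (z i)).choose = z i :=
      fun z i => (Submodule.Quotient.mk_surjective (W i) (z i)).choose_spec
    obtain ⟨x, rfl⟩ := Submodule.Quotient.mk_surjective _ x
    let c : ∀ i, V i := fun i => (Submodule.Quotient.mk_surjective (W i) (m i)).choose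
    have e : ∀ v : V i, f (fun i' => (Submodule.Quotient.mk_surjective (W i')
        (Function.update m i (Submodule.Quotient.mk v) i')).choose)
        = f (Function.update c i v) := by
      intro v
      refine multilinear_congr_mod W f hf _ _ fun i' => ?_
      rw [← Submodule.Quotient.eq, hc]
      by_cases h : i' = i
      · subst h; simp
      · simp [h, c, hc]
    rw [← Submodule.Quotient.mk_smul, e, e, f.map_update_smul]

theorem multilinearQuotLift_mk (W : ∀ i, Submodule k (V i)) (f : MultilinearMap k V N)
    (hf : ∀ c i, c i ∈ W i → f c = 0) (c : ∀ i, V i) :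
    multilinearQuotLift W f hf (fun i => Submodule.Quotient.mk (c i)) = f c := by
  refine multilinear_congr_mod W f hf _ _ fun i => ?_
  rw [← Submodule.Quotient.eq]
  exact (Submodule.Quotient.mk_surjective (W i) _).choose_spec

end QuotientLift

section Quotient

variable {k : Type u} [Field k] {P : ShuffleOperad.{u, v} k} (N : P.Ideal)

/-- The composition of the quotient of a shuffle operad by an ideal. -/
noncomputable def ShuffleOperad.Ideal.quotComp {J : Finset ℕ} {K : {j // j ∈ J} → Finset ℕ}
    {I : Finset ℕ} (h : Blocks MinLT J K I) :
    (P.obj J ⧸ N.carrier J) →ₗ[k]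
      MultilinearMap k (fun j : {j // j ∈ J} => P.obj (K j) ⧸ N.carrier (K j))
        (P.obj I ⧸ N.carrier I) :=
  Submodule.liftQ (N.carrier J)
    { toFun := fun a => multilinearQuotLift (fun j => N.carrier (K j))
        ((N.carrier I).mkQ.compMultilinearMap (P.comp h a)) (by
          intro c i hi
          simpa using N.comp_right h a c i hi)
      map_add' := by
        intro a b
        ext x
        obtain ⟨c, rfl⟩ : ∃ c : ∀ j, P.obj (K j), x = fun j => Submodule.Quotient.mk (c j) :=
          ⟨fun j => (Submodule.Quotient.mk_surjective _ (x j)).choose,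
            funext fun j => ((Submodule.Quotient.mk_surjective _ (x j)).choose_spec).symm⟩
        rw [_root_.add_apply]
        simp only [multilinearQuotLift_mk]
        simp
      map_smul' := by
        intro r a
        ext x
        obtain ⟨c, rfl⟩ : ∃ c : ∀ j, P.obj (K j), x = fun j => Submodule.Quotient.mk (c j) :=
          ⟨fun j => (Submodule.Quotient.mk_surjective _ (x j)).choose,
            funext fun j => ((Submodule.Quotient.mk_surjective _ (x j)).choose_spec).symm⟩
        rw [RingHom.id_apply, _root_.smul_apply]
        simp only [multilinearQuotLift_mk]
        simp }
    (by
      intro a ha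
      rw [LinearMap.mem_ker]
      ext x
      obtain ⟨c, rfl⟩ : ∃ c : ∀ j, P.obj (K j), x = fun j => Submodule.Quotient.mk (c j) :=
        ⟨fun j => (Submodule.Quotient.mk_surjective _ (x j)).choose,
          funext fun j => ((Submodule.Quotient.mk_surjective _ (x j)).choose_spec).symm⟩
      simp only [LinearMap.coe_mk, AddHom.coe_mk, multilinearQuotLift_mk]
      simpa using N.comp_left h a c ha)

theorem ShuffleOperad.Ideal.quotComp_mk {J : Finset ℕ} {K : {j // j ∈ J} → Finset ℕ}
    {I : Finset ℕ} (h : Blocks MinLT J K I) (a : P.obj J) (c : ∀ j, P.obj (K j)) :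
    N.quotComp h (Submodule.Quotient.mk a) (fun j => Submodule.Quotient.mk (c j))
      = Submodule.Quotient.mk (P.comp h a c) :=
  multilinearQuotLift_mk (fun j => N.carrier (K j))
    ((N.carrier I).mkQ.compMultilinearMap (P.comp h a))
    (fun c i hi => by simpa using N.comp_right h a c i hi) c

/-- The quotient of a shuffle operad by an ideal. -/
noncomputable def ShuffleOperad.Ideal.quotient : ShuffleOperad.{u, v} k where
  obj I := P.obj I ⧸ N.carrier I
  subsingleton_empty := by
    have := P.subsingleton_empty
    exact (Submodule.Quotient.mk_surjective (N.carrier ∅)).subsingleton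
  unit x := Submodule.Quotient.mk (P.unit x)
  comp h := N.quotComp h
  unit_comp h a := by
    obtain ⟨a, rfl⟩ := Submodule.Quotient.mk_surjective _ a
    rw [N.quotComp_mk h, P.unit_comp]
  comp_unit h a := by
    obtain ⟨a, rfl⟩ := Submodule.Quotient.mk_surjective _ a
    rw [N.quotComp_mk h, P.comp_unit]
  assoc {L J I G K M} hG hK hM hsub hGM a b c := by
    obtain ⟨a, rfl⟩ := Submodule.Quotient.mk_surjective _ a
    obtain ⟨b, rfl⟩ : ∃ b' : ∀ l, P.obj (G l), b = fun j => Submodule.Quotient.mk (b' j) :=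
      ⟨fun j => (Submodule.Quotient.mk_surjective _ (b j)).choose,
        funext fun j => ((Submodule.Quotient.mk_surjective _ (b j)).choose_spec).symm⟩
    obtain ⟨c, rfl⟩ : ∃ c' : ∀ j, P.obj (K j), c = fun j => Submodule.Quotient.mk (c' j) :=
      ⟨fun j => (Submodule.Quotient.mk_surjective _ (c j)).choose,
        funext fun j => ((Submodule.Quotient.mk_surjective _ (c j)).choose_spec).symm⟩
    have e : ∀ l, N.quotComp (hGM l) (Submodule.Quotient.mk (b l))
        (fun j => Submodule.Quotient.mk (c ⟨j.1, hsub l j.1 j.2⟩)) = _ :=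
      fun l => N.quotComp_mk (hGM l) (b l) _
    simp only [e]
    rw [N.quotComp_mk hG, N.quotComp_mk hK, N.quotComp_mk hM, P.assoc hG hK hM hsub hGM]

/-- The class of an element in the quotient operad. -/
def ShuffleOperad.Ideal.toQuotient {I : Finset ℕ} (a : P.obj I) : N.quotient.obj I :=
  (Submodule.Quotient.mk a : P.obj I ⧸ N.carrier I)

end Quotient

/-! ### Tree monomials -/

/-- Planar rooted trees with vertices decorated by `b : B` having `ar b ≥ 1` inputs, and with leaves
labelled by natural numbers. -/
inductive LTree {B : Type v} (ar : B → ℕ+) : Type v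
  | leaf (i : ℕ) : LTree ar
  | node (b : B) (ch : Fin (ar b : ℕ) → LTree ar) : LTree ar

namespace LTree

variable {B : Type v} {ar : B → ℕ+}

/-- The set of leaf labels. -/
def leaves : LTree ar → Finset ℕ
  | leaf i => {i}
  | node _ ch => Finset.univ.biUnion fun i => (ch i).leaves

theorem leaves_nonempty : ∀ t : LTree ar, t.leaves.Nonempty
  | leaf i => Finset.singleton_nonempty i
  | node b ch => by
    obtain ⟨x, hx⟩ := leaves_nonempty (ch ⟨0, (ar b).pos⟩)
    exact ⟨x, Finset.mem_biUnion.2 ⟨_, Finset.mem_univ _, hx⟩⟩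

/-- The smallest leaf label. -/
def minLeaf (t : LTree ar) : ℕ := t.leaves.min' t.leaves_nonempty

/-- The leaf labels are distinct, and the tree is the canonical planar representative: the inputs of
each vertex are ordered by the smallest leaves that can be reached from them. -/
def IsShuffle : LTree ar → Prop
  | leaf _ => True
  | node _ ch => (∀ i, (ch i).IsShuffle) ∧ (∀ i j, i ≠ j → Disjoint (ch i).leaves (ch j).leaves) ∧
      ∀ i j, i < j → (ch i).minLeaf < (ch j).minLeaf

/-- Grafting: replace the leaf labelled `j` by the tree `s j`. -/
def graft (s : ℕ → LTree ar) : LTree ar → LTree ar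
  | leaf i => s i
  | node b ch => node b fun i => graft s (ch i)

/-- Change of the leaf labels. -/
def relabel (σ : ℕ → ℕ) : LTree ar → LTree ar
  | leaf i => leaf (σ i)
  | node b ch => node b fun i => relabel σ (ch i)

/-- `IsMaxSubtree t w`: `w` is the (maximal) subtree of `t` rooted at some vertex or leaf of `t`. -/
inductive IsMaxSubtree : LTree ar → LTree ar → Prop
  | refl (t : LTree ar) : IsMaxSubtree t t
  | child {b : B} {ch : Fin (ar b : ℕ) → LTree ar} {w : LTree ar} (i : Fin (ar b : ℕ)) :
      IsMaxSubtree (ch i) w → IsMaxSubtree (node b ch) w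

/-- `IsTop t u`: `u` is a subtree of `t` that contains the root of `t`, each leaf of `u` being
labelled by the smallest leaf of `t` that can be reached from it. -/
inductive IsTop : LTree ar → LTree ar → Prop
  | cut (t : LTree ar) : IsTop t (leaf t.minLeaf)
  | node (b : B) (ch ch' : Fin (ar b : ℕ) → LTree ar) :
      (∀ i, IsTop (ch i) (ch' i)) → IsTop (node b ch) (node b ch')

/-- `t` is divisible by `d`: the tree monomial of some subtree of `t` is equal to `d` (up to the
order-preserving relabelling of leaves). -/
def Divides (d t : LTree ar) : Prop :=
  ∃ w u, IsMaxSubtree t w ∧ IsTop w u ∧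
    ∃ σ : ℕ → ℕ, StrictMonoOn σ (u.leaves : Set ℕ) ∧ u.relabel σ = d

/-- `A` is an interval of the finite ordered set `I`. -/
def _root_.IsIntervalIn (A I : Finset ℕ) : Prop :=
  ∀ a ∈ A, ∀ b ∈ A, ∀ c ∈ I, a < c → c < b → c ∈ A

/-- A tree is prime if it has a root vertex, and the subtrees rooted at all other vertices are not
connected, i.e. their leaves do not form intervals in the set of all leaves. -/
def IsPrime : LTree ar → Prop
  | leaf _ => False
  | node b ch => ∀ (i : Fin (ar b : ℕ)) (b' : B) (ch' : Fin (ar b' : ℕ) → LTree ar),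
      IsMaxSubtree (ch i) (node b' ch') →
        ¬ IsIntervalIn (node b' ch').leaves (node b ch).leaves

theorem mem_leaves_graft (s : ℕ → LTree ar) (x : ℕ) :
    ∀ t : LTree ar, x ∈ (t.graft s).leaves ↔ ∃ j ∈ t.leaves, x ∈ (s j).leaves
  | leaf i => by simp [graft, leaves]
  | node b ch => by
    simp only [graft, leaves, Finset.mem_biUnion, Finset.mem_univ, true_and,
      fun i => mem_leaves_graft s x (ch i)]
    constructor
    · rintro ⟨i, j, hj, hx⟩
      exact ⟨j, ⟨i, hj⟩, hx⟩
    · rintro ⟨j, ⟨i, hj⟩, hx⟩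
      exact ⟨i, j, hj, hx⟩

theorem minLeaf_mem (t : LTree ar) : t.minLeaf ∈ t.leaves := Finset.min'_mem _ _

theorem minLeaf_le {t : LTree ar} {x : ℕ} (h : x ∈ t.leaves) : t.minLeaf ≤ x :=
  Finset.min'_le _ _ h

theorem IsShuffle.graft {s : ℕ → LTree ar} : ∀ {t : LTree ar}, t.IsShuffle →
    (∀ j ∈ t.leaves, (s j).IsShuffle) →
    (∀ j ∈ t.leaves, ∀ j' ∈ t.leaves, j ≠ j' → Disjoint (s j).leaves (s j').leaves) →
    (∀ j ∈ t.leaves, ∀ j' ∈ t.leaves, j < j' → (s j).minLeaf < (s j').minLeaf) →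
    (t.graft s).IsShuffle
  | leaf i, _, hs, _, _ => hs i (by simp [leaves])
  | node b ch, ht, hs, hd, hm => by
    have sub : ∀ i, ∀ j ∈ (ch i).leaves, j ∈ (node b ch).leaves := fun i j hj =>
      Finset.mem_biUnion.2 ⟨i, Finset.mem_univ i, hj⟩
    refine ⟨fun i => (ht.1 i).graft (fun j hj => hs j (sub i j hj))
      (fun j hj j' hj' => hd j (sub i j hj) j' (sub i j' hj'))
      (fun j hj j' hj' => hm j (sub i j hj) j' (sub i j' hj')), ?_, ?_⟩
    · intro i i' hi
      rw [Finset.disjoint_left]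
      intro x hx hx'
      rw [mem_leaves_graft] at hx hx'
      obtain ⟨j, hj, hx⟩ := hx
      obtain ⟨j', hj', hx'⟩ := hx'
      have hne : j ≠ j' := by
        rintro rfl
        exact Finset.disjoint_left.1 (ht.2.1 i i' hi) hj hj'
      exact Finset.disjoint_left.1 (hd j (sub i j hj) j' (sub i' j' hj') hne) hx hx'
    · intro i i' hi
      obtain ⟨j', hj', hx'⟩ := (mem_leaves_graft s _ (ch i')).1 (minLeaf_mem ((ch i').graft s))
      have h1 : (ch i).minLeaf < j' := (ht.2.2 i i' hi).trans_le (minLeaf_le hj')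
      have h2 := hm _ (sub i _ (minLeaf_mem _)) _ (sub i' _ hj') h1
      have h3 : ((ch i).graft s).minLeaf ≤ (s (ch i).minLeaf).minLeaf :=
        minLeaf_le ((mem_leaves_graft s _ _).2 ⟨_, minLeaf_mem _, minLeaf_mem _⟩)
      exact h3.trans_lt (h2.trans_le (minLeaf_le hx'))

theorem graft_congr {s s' : ℕ → LTree ar} : ∀ {t : LTree ar}, (∀ j ∈ t.leaves, s j = s' j) →
    t.graft s = t.graft s'
  | leaf i, h => h i (by simp [leaves])
  | node b ch, h => by
    simp only [graft]
    congr 1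
    funext i
    exact graft_congr fun j hj => h j (Finset.mem_biUnion.2 ⟨i, Finset.mem_univ i, hj⟩)

theorem graft_leaf : ∀ t : LTree ar, t.graft leaf = t
  | leaf _ => rfl
  | node b ch => by simp only [graft, fun i => graft_leaf (ch i)]

theorem graft_graft (s s' : ℕ → LTree ar) : ∀ t : LTree ar,
    (t.graft s).graft s' = t.graft fun j => (s j).graft s'
  | leaf _ => rfl
  | node b ch => by simp only [graft, fun i => graft_graft s s' (ch i)]

end LTree

/-- Tree monomials whose leaves are labelled by the finite ordered set `I`. -/
def TreeMonomial {B : Type v} (ar : B → ℕ+) (I : Finset ℕ) : Type v :=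
  {t : LTree ar // t.IsShuffle ∧ t.leaves = I}

namespace TreeMonomial

variable {B : Type v} {ar : B → ℕ+}

/-- The shuffle composition of tree monomials. -/
def graft {J : Finset ℕ} {K : {j // j ∈ J} → Finset ℕ} {I : Finset ℕ} (h : Blocks MinLT J K I)
    (t : TreeMonomial ar J) (s : ∀ j, TreeMonomial ar (K j)) : TreeMonomial ar I :=
  ⟨t.1.graft fun j => if hj : j ∈ J then (s ⟨j, hj⟩).1 else .leaf j, by
    obtain ⟨t, ht, rfl⟩ := t
    constructor
    · refine ht.graft ?_ ?_ ?_
      · intro j hj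
        simpa [hj] using (s ⟨j, hj⟩).2.1
      · intro j hj j' hj' hne
        simp only [hj, hj', dif_pos, (s ⟨j, hj⟩).2.2, (s ⟨j', hj'⟩).2.2]
        exact h.disjoint _ _ (by simpa using hne)
      · intro j hj j' hj' hlt
        simp only [hj, hj', dif_pos]
        obtain ⟨a, ha, hb⟩ := h.order ⟨j, hj⟩ ⟨j', hj'⟩ hlt
        rw [← (s ⟨j, hj⟩).2.2] at ha
        refine (LTree.minLeaf_le ha).trans_lt (hb _ ?_)
        have := LTree.minLeaf_mem (s ⟨j', hj'⟩).1
        rwa [(s ⟨j', hj'⟩).2.2] at this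
    · ext x
      rw [LTree.mem_leaves_graft, h.mem_iff]
      constructor
      · rintro ⟨j, hj, hx⟩
        simp only [hj, dif_pos, (s ⟨j, hj⟩).2.2] at hx
        exact ⟨⟨j, hj⟩, hx⟩
      · rintro ⟨⟨j, hj⟩, hx⟩
        refine ⟨j, hj, ?_⟩
        simpa only [hj, dif_pos, (s ⟨j, hj⟩).2.2] using hx⟩

/-- The degenerate tree. -/
def unit (x : ℕ) : TreeMonomial ar {x} := ⟨.leaf x, trivial, rfl⟩

theorem unit_graft {x : ℕ} {I : Finset ℕ} (h : Blocks MinLT {x} (fun _ => I) I)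
    (t : TreeMonomial ar I) : graft h (unit x) (fun _ => t) = t := by
  apply Subtype.ext
  simp [graft, unit, LTree.graft]

theorem graft_unit {J : Finset ℕ} (h : Blocks MinLT J (fun j => {j.1}) J)
    (t : TreeMonomial ar J) : graft h t (fun j => unit j.1) = t := by
  apply Subtype.ext
  refine Eq.trans ?_ (LTree.graft_leaf t.1)
  refine LTree.graft_congr fun j hj => ?_
  rw [t.2.2] at hj
  simp [hj, unit]

theorem graft_assoc {L J I : Finset ℕ} {G : {l // l ∈ L} → Finset ℕ} {K : {j // j ∈ J} → Finset ℕ}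
    {M : {l // l ∈ L} → Finset ℕ} (hG : Blocks MinLT L G J) (hK : Blocks MinLT J K I)
    (hM : Blocks MinLT L M I) (hsub : ∀ l, ∀ j ∈ G l, j ∈ J)
    (hGM : ∀ l, Blocks MinLT (G l) (fun j => K ⟨j.1, hsub l j.1 j.2⟩) (M l))
    (a : TreeMonomial ar L) (b : ∀ l, TreeMonomial ar (G l)) (c : ∀ j, TreeMonomial ar (K j)) :
    graft hK (graft hG a b) c =
      graft hM a (fun l => graft (hGM l) (b l) (fun j => c ⟨j.1, hsub l j.1 j.2⟩)) := by
  apply Subtype.ext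
  simp only [graft]
  rw [LTree.graft_graft]
  refine LTree.graft_congr fun l hl => ?_
  rw [a.2.2] at hl
  simp only [hl, dif_pos]
  refine LTree.graft_congr fun j hj => ?_
  rw [(b ⟨l, hl⟩).2.2] at hj
  simp only [hj, hsub ⟨l, hl⟩ j hj, dif_pos]

theorem isEmpty_empty : IsEmpty (TreeMonomial ar ∅) :=
  ⟨fun t => by simpa [t.2.2] using t.1.leaves_nonempty⟩

end TreeMonomial

/-! ### The free shuffle operad -/

section Free

variable (k : Type u) [Field k]

/-- The multilinear extension of a function on basis elements. -/
noncomputable def multilinearExtend {ι : Type} [Fintype ι] [DecidableEq ι] {κ : ι → Type v}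
    {N : Type w} [AddCommGroup N] [Module k N] (f : (∀ i, κ i) → N) :
    MultilinearMap k (fun i => κ i →₀ k) N :=
  open Classical in
  (MultilinearMap.fromDFinsuppEquiv κ k
    (fun p => MultilinearMap.mkPiRing k ι (f p))).compLinearMap
      (fun i => (finsuppLequivDFinsupp k : (κ i →₀ k) ≃ₗ[k] _).toLinearMap)

theorem multilinearExtend_single {ι : Type} [Fintype ι] [DecidableEq ι] {κ : ι → Type v}
    {N : Type w} [AddCommGroup N] [Module k N] (f : (∀ i, κ i) → N) (p : ∀ i, κ i) :
    multilinearExtend k f (fun i => Finsupp.single (p i) 1) = f p := by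
  classical
  simp [multilinearExtend]

variable {B : Type v} (ar : B → ℕ+)

/-- The shuffle composition of the free operad: the multilinear extension of the shuffle composition
of tree monomials. -/
noncomputable def freeComp {J : Finset ℕ} {K : {j // j ∈ J} → Finset ℕ} {I : Finset ℕ}
    (h : Blocks MinLT J K I) : (TreeMonomial ar J →₀ k) →ₗ[k]
      MultilinearMap k (fun j : {j // j ∈ J} => TreeMonomial ar (K j) →₀ k)
        (TreeMonomial ar I →₀ k) :=
  Finsupp.linearCombination k fun t =>
    multilinearExtend k fun s => Finsupp.single (TreeMonomial.graft h t s) 1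

theorem freeComp_single {J : Finset ℕ} {K : {j // j ∈ J} → Finset ℕ} {I : Finset ℕ}
    (h : Blocks MinLT J K I) (t : TreeMonomial ar J) (s : ∀ j, TreeMonomial ar (K j)) :
    freeComp k ar h (Finsupp.single t 1) (fun j => Finsupp.single (s j) 1)
      = Finsupp.single (TreeMonomial.graft h t s) 1 := by
  simp [freeComp, multilinearExtend_single]

theorem freeComp_assoc {L J I : Finset ℕ} {G : {l // l ∈ L} → Finset ℕ}
    {K : {j // j ∈ J} → Finset ℕ} {M : {l // l ∈ L} → Finset ℕ} (hG : Blocks MinLT L G J)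
    (hK : Blocks MinLT J K I) (hM : Blocks MinLT L M I) (hsub : ∀ l, ∀ j ∈ G l, j ∈ J)
    (hGM : ∀ l, Blocks MinLT (G l) (fun j => K ⟨j.1, hsub l j.1 j.2⟩) (M l))
    (a : TreeMonomial ar L →₀ k) (b : ∀ l, TreeMonomial ar (G l) →₀ k)
    (c : ∀ j, TreeMonomial ar (K j) →₀ k) :
    freeComp k ar hK (freeComp k ar hG a b) c = freeComp k ar hM a
      (fun l => freeComp k ar (hGM l) (b l) (fun j => c ⟨j.1, hsub l j.1 j.2⟩)) := by
  classical
  induction a using Finsupp.induction_linear with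
  | zero => simp
  | add x y hx hy => simp [hx, hy]
  | single t r =>
    rw [← mul_one r, ← smul_eq_mul, ← Finsupp.smul_single]
    simp only [map_smul, _root_.smul_apply]
    congr 1
    -- linearity in `b`
    let evalc : (TreeMonomial ar J →₀ k) →ₗ[k] (TreeMonomial ar I →₀ k) :=
      { toFun := fun x => freeComp k ar hK x c
        map_add' := by simp
        map_smul' := by simp }
    let gl : ∀ l, (TreeMonomial ar (G l) →₀ k) →ₗ[k] (TreeMonomial ar (M l) →₀ k) := fun l =>
      { toFun := fun x => freeComp k ar (hGM l) x (fun j => c ⟨j.1, hsub l j.1 j.2⟩)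
        map_add' := by simp
        map_smul' := by simp }
    suffices hb : evalc.compMultilinearMap (freeComp k ar hG (Finsupp.single t 1))
        = (freeComp k ar hM (Finsupp.single t 1)).compLinearMap gl from
      DFunLike.congr_fun hb b
    refine Module.Basis.ext_multilinear (fun l => Finsupp.basisSingleOne) fun v => ?_
    simp only [Finsupp.coe_basisSingleOne, LinearMap.compMultilinearMap_apply,
      MultilinearMap.compLinearMap_apply, freeComp_single, evalc, gl, LinearMap.coe_mk,
      AddHom.coe_mk]
    -- linearity in `c`
    have loc : ∀ j : {j // j ∈ J}, ∃ l, j.1 ∈ G l := fun j => (hG.mem_iff j.1).1 j.2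
    have key : ∀ (c : ∀ j, TreeMonomial ar (K j) →₀ k) (j₀ : {j // j ∈ J}) (l₀) (h₀ : j₀.1 ∈ G l₀)
        (x : TreeMonomial ar (K j₀) →₀ k),
        (fun l => freeComp k ar (hGM l) (Finsupp.single (v l) 1)
          (fun j => Function.update c j₀ x ⟨j.1, hsub l j.1 j.2⟩))
        = Function.update (fun l => freeComp k ar (hGM l) (Finsupp.single (v l) 1)
          (fun j => c ⟨j.1, hsub l j.1 j.2⟩)) l₀
          (freeComp k ar (hGM l₀) (Finsupp.single (v l₀) 1)
            (Function.update (fun j : {j // j ∈ G l₀} => c ⟨j.1, hsub l₀ j.1 j.2⟩) ⟨j₀.1, h₀⟩ x)) := by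
      intro c j₀ l₀ h₀ x
      funext l
      by_cases hl : l = l₀
      · subst hl
        rw [Function.update_self]
        congr 1
        funext j
        by_cases hj : j = ⟨j₀.1, h₀⟩
        · subst hj; simp
        · rw [Function.update_of_ne hj, Function.update_of_ne]
          intro h
          exact hj (Subtype.ext (show j.1 = j₀.1 from congrArg Subtype.val h))
      · rw [Function.update_of_ne hl]
        congr 1
        funext j
        rw [Function.update_of_ne]
        rintro rfl
        exact Finset.disjoint_left.1 (hG.disjoint l l₀ hl) j.2 h₀
    let rhs : MultilinearMap k (fun j : {j // j ∈ J} => TreeMonomial ar (K j) →₀ k)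
        (TreeMonomial ar I →₀ k) := MultilinearMap.mk'
      (fun c => freeComp k ar hM (Finsupp.single t 1)
        (fun l => freeComp k ar (hGM l) (Finsupp.single (v l) 1)
          (fun j => c ⟨j.1, hsub l j.1 j.2⟩)))
      (by
        intro c j₀ x y
        obtain ⟨l₀, h₀⟩ := loc j₀
        simp only [key c j₀ l₀ h₀, MultilinearMap.map_update_add])
      (by
        intro c j₀ r x
        obtain ⟨l₀, h₀⟩ := loc j₀
        simp only [key c j₀ l₀ h₀, MultilinearMap.map_update_smul])
    suffices hc : freeComp k ar hK (Finsupp.single (TreeMonomial.graft hG t v) 1) = rhs from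
      DFunLike.congr_fun hc c
    refine Module.Basis.ext_multilinear (fun l => Finsupp.basisSingleOne) fun s => ?_
    have e : ∀ l, freeComp k ar (hGM l) (Finsupp.single (v l) 1)
        (fun j => Finsupp.single (s ⟨j.1, hsub l j.1 j.2⟩) 1) = _ :=
      fun l => freeComp_single k ar (hGM l) (v l) _
    simp only [Finsupp.coe_basisSingleOne, rhs, MultilinearMap.mk', MultilinearMap.coe_mk, e,
      freeComp_single]
    rw [TreeMonomial.graft_assoc hG hK hM hsub hGM]

/-- The free shuffle operad `F_V`, where `V` is the collection whose component of arity `n` has the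
basis `{b : B | ar b = n}`. Its component on `I` has the tree monomials on `I` as a basis. -/
noncomputable def freeShuffle : ShuffleOperad.{u, max u v} k where
  obj I := TreeMonomial ar I →₀ k
  subsingleton_empty := by
    have := TreeMonomial.isEmpty_empty (ar := ar)
    infer_instance
  unit x := Finsupp.single (TreeMonomial.unit x) 1
  comp h := freeComp k ar h
  unit_comp {x I} h a := by
    have e : ∀ y : TreeMonomial ar I →₀ k, (fun _ : {j // j ∈ ({x} : Finset ℕ)} => y)
        = Function.update (fun _ => 0) ⟨x, Finset.mem_singleton_self x⟩ y := by
      intro y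
      funext j
      have hj : j = ⟨x, Finset.mem_singleton_self x⟩ :=
        Subtype.ext (Finset.mem_singleton.1 j.2)
      rw [hj, Function.update_self]
    induction a using Finsupp.induction_linear with
    | zero =>
      exact (freeComp k ar h _).map_coord_zero ⟨x, Finset.mem_singleton_self x⟩ rfl
    | add y z hy hz =>
      rw [e, MultilinearMap.map_update_add, ← e, ← e, hy, hz]
    | single t r =>
      rw [← mul_one r, ← smul_eq_mul, ← Finsupp.smul_single, e, MultilinearMap.map_update_smul,
        ← e, freeComp_single, TreeMonomial.unit_graft]
  comp_unit h a := by
    induction a using Finsupp.induction_linear with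
    | zero => simp
    | add x y hx hy => rw [map_add, _root_.add_apply, hx, hy]
    | single t r =>
      rw [← mul_one r, ← smul_eq_mul, ← Finsupp.smul_single, map_smul, _root_.smul_apply,
        freeComp_single, TreeMonomial.graft_unit]
  assoc hG hK hM hsub hGM a b c := freeComp_assoc k ar hG hK hM hsub hGM a b c

end Free

/-! ### Gröbner bases -/

/-- Admissible orderings of tree monomials (with the same leaf labels): well-orders for which
replacing the operations in any shuffle composition with larger ones increases the result. -/
structure AdmissibleOrder {B : Type v} (ar : B → ℕ+) where
  lt : ∀ I, TreeMonomial ar I → TreeMonomial ar I → Prop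
  isWellOrder : ∀ I, IsWellOrder (TreeMonomial ar I) (lt I)
  graft_lt_left : ∀ {J : Finset ℕ} {K : {j // j ∈ J} → Finset ℕ} {I : Finset ℕ}
    (h : Blocks MinLT J K I) (t t' : TreeMonomial ar J) (s : ∀ j, TreeMonomial ar (K j)),
    lt J t t' → lt I (TreeMonomial.graft h t s) (TreeMonomial.graft h t' s)
  graft_lt_right : ∀ {J : Finset ℕ} {K : {j // j ∈ J} → Finset ℕ} {I : Finset ℕ}
    (h : Blocks MinLT J K I) (t : TreeMonomial ar J) (s s' : ∀ j, TreeMonomial ar (K j))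
    (j : {j // j ∈ J}), (∀ j', j' ≠ j → s j' = s' j') → lt (K j) (s j) (s' j) →
    lt I (TreeMonomial.graft h t s) (TreeMonomial.graft h t s')

section Groebner

variable {k : Type u} [Field k] {B : Type v} {ar : B → ℕ+}

/-- `t` is the leading term of `f`: the largest of the tree monomials occurring in `f` with a
nonzero coefficient. -/
def AdmissibleOrder.IsLeadingTerm (o : AdmissibleOrder ar) {I : Finset ℕ}
    (f : TreeMonomial ar I →₀ k) (t : TreeMonomial ar I) : Prop :=
  t ∈ f.support ∧ ∀ t' ∈ f.support, t' ≠ t → o.lt I t' t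

/-- `G` is a Gröbner basis of the ideal `N` of the free shuffle operad: it generates `N`, and the
leading term of each nonzero element of `N` is divisible by the leading term of some element
of `G`. -/
def AdmissibleOrder.IsGroebnerBasis (o : AdmissibleOrder ar) (N : (freeShuffle k ar).Ideal)
    (G : ∀ I, Set (TreeMonomial ar I →₀ k)) : Prop :=
  (freeShuffle k ar).idealSpan G = N ∧
    ∀ (I : Finset ℕ) (f : TreeMonomial ar I →₀ k) (t : TreeMonomial ar I),
      f ∈ N.carrier I → o.IsLeadingTerm f t →
        ∃ (I' : Finset ℕ) (g : TreeMonomial ar I' →₀ k) (t' : TreeMonomial ar I'),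
          g ∈ G I' ∧ o.IsLeadingTerm g t' ∧ t'.1.Divides t.1

/-- Normal tree monomials: those not divisible by the leading term of any element of `G`. -/
def AdmissibleOrder.IsNormal (o : AdmissibleOrder ar) (G : ∀ I, Set (TreeMonomial ar I →₀ k))
    (t : LTree ar) : Prop :=
  ∀ (I : Finset ℕ) (g : TreeMonomial ar I →₀ k) (t' : TreeMonomial ar I),
    g ∈ G I → o.IsLeadingTerm g t' → ¬ t'.1.Divides t

/-- Prime normal tree monomials of all arities, with leaves labelled by `0, …, arity - 1`. -/
structure PrimeNormalMonomial (o : AdmissibleOrder ar) (G : ∀ I, Set (TreeMonomial ar I →₀ k)) where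
  arity : ℕ
  tree : TreeMonomial ar (Finset.range arity)
  isPrime : tree.1.IsPrime
  isNormal : o.IsNormal G tree.1

end Groebner

/-!
Call a grafting of trees nonsymmetric if the leaf sets of the grafted trees follow one another in
increasing order. Every tree monomial other than the degenerate one is a nonsymmetric grafting
`p ∘ (t₁, …, tₙ)` with `p` prime, in exactly one way: the roots of the `tⱼ` are the highest places
below the root of `p` whose leaves form an interval
(`LTree.PrimeFactorization.nonempty`, `LTree.PrimeFactorization.unique`). So tree monomials form a
free nonsymmetric operad on the prime ones, and arbitrary values on prime tree monomials in a
nonsymmetric operad extend recursively to all tree monomials, compatibly with nonsymmetric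
compositions (`NSOperad.evalTree_graft`).

A prime tree monomial `d` that divides `p ∘ (t₁, …, tₙ)` divides `p` or some `tⱼ`, because an
occurrence of `d` that reaches from `p` into a vertex of `tⱼ` would give `d` a non-root vertex whose
leaves form an interval (`LTree.PrimeFactorization.divides_iff`). As the leading terms of the
Gröbner basis are prime, a tree monomial is thus normal if and only if all its prime factors are normal;
in particular, nonsymmetric compositions of normal tree monomials are normal.

Finally, the classes of normal tree monomials form a basis of the quotient operad
(`AdmissibleOrder.IsGroebnerBasis.basis`): they span since every multiple of a leading term
of an element of the ideal is again such a leading term, and they are independent since the leading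
term of a nonzero element of the ideal is not normal. By the above, nonsymmetric compositions of
elements of this basis belong to it, and the basis is, together with these compositions, the free
nonsymmetric operad on the prime normal tree monomials.
-/

namespace LTree

variable {B : Type v} {ar : B → ℕ+}

/-! ### Subtrees, truncations and grafting -/

theorem leaves_child_subset {b : B} (ch : Fin (ar b : ℕ) → LTree ar) (i : Fin (ar b : ℕ)) :
    (ch i).leaves ⊆ (node b ch).leaves := fun _ hx =>
  Finset.mem_biUnion.2 ⟨i, Finset.mem_univ i, hx⟩

theorem mem_leaves_node {b : B} {ch : Fin (ar b : ℕ) → LTree ar} {x : ℕ} :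
    x ∈ (node b ch).leaves ↔ ∃ i, x ∈ (ch i).leaves := by
  simp [leaves]

@[simp]
theorem minLeaf_leaf (x : ℕ) : (leaf x : LTree ar).minLeaf = x := by
  simp [minLeaf, leaves]

theorem relabel_eq_graft (σ : ℕ → ℕ) : ∀ t : LTree ar, t.relabel σ = t.graft fun j => leaf (σ j)
  | leaf _ => rfl
  | node b ch => by simp only [relabel, graft, fun i => relabel_eq_graft σ (ch i)]

theorem leaves_relabel (σ : ℕ → ℕ) (t : LTree ar) : (t.relabel σ).leaves = t.leaves.image σ := by
  ext x
  simp [relabel_eq_graft, mem_leaves_graft, leaves, eq_comm]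

theorem graft_relabel (σ : ℕ → ℕ) (s : ℕ → LTree ar) (t : LTree ar) :
    (t.relabel σ).graft s = t.graft fun j => s (σ j) := by
  rw [relabel_eq_graft, graft_graft]
  rfl

theorem minLeaf_graft {s : ℕ → LTree ar} {t : LTree ar}
    (hs : StrictMonoOn (fun j => (s j).minLeaf) (t.leaves : Set ℕ)) :
    (t.graft s).minLeaf = (s t.minLeaf).minLeaf := by
  apply le_antisymm
  · exact minLeaf_le ((mem_leaves_graft s _ _).2 ⟨_, minLeaf_mem t, minLeaf_mem _⟩)
  · obtain ⟨j, hj, hx⟩ := (mem_leaves_graft s _ t).1 (minLeaf_mem (t.graft s))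
    exact (hs.monotoneOn (minLeaf_mem t) hj (minLeaf_le hj)).trans (minLeaf_le hx)

/-- The number of vertices. -/
def size : LTree ar → ℕ
  | leaf _ => 0
  | node _ ch => 1 + ∑ i, (ch i).size

theorem size_child_lt {b : B} (ch : Fin (ar b : ℕ) → LTree ar) (i : Fin (ar b : ℕ)) :
    (ch i).size < (node b ch).size := by
  have := Finset.single_le_sum (f := fun i => (ch i).size) (fun _ _ => Nat.zero_le _)
    (Finset.mem_univ i)
  simp only [size]
  omega

theorem size_le_size_graft (s : ℕ → LTree ar) : ∀ t : LTree ar, t.size ≤ (t.graft s).size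
  | leaf _ => Nat.zero_le _
  | node b ch => by
    simp only [graft, size]
    gcongr with i
    exact size_le_size_graft s (ch i)

theorem size_add_size_le_size_graft (s : ℕ → LTree ar) {x : ℕ} : ∀ {t : LTree ar}, x ∈ t.leaves →
    t.size + (s x).size ≤ (t.graft s).size
  | leaf i, h => by
    obtain rfl : x = i := by simpa [leaves] using h
    simp [size, graft]
  | node b ch, h => by
    obtain ⟨i, hi⟩ := mem_leaves_node.1 h
    have h1 := size_add_size_le_size_graft s hi
    simp only [graft, size]
    rw [← Finset.add_sum_erase _ _ (Finset.mem_univ i),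
      ← Finset.add_sum_erase _ (fun i => ((ch i).graft s).size) (Finset.mem_univ i)]
    have h2 : ∑ l ∈ Finset.univ.erase i, (ch l).size
        ≤ ∑ l ∈ Finset.univ.erase i, ((ch l).graft s).size :=
      Finset.sum_le_sum fun l _ => size_le_size_graft s (ch l)
    omega

namespace IsMaxSubtree

theorem trans {t w x : LTree ar} (h : IsMaxSubtree t w) (h' : IsMaxSubtree w x) :
    IsMaxSubtree t x := by
  induction h with
  | refl t => exact h'
  | child i _ ih => exact .child i (ih h')

theorem leaves_subset {t w : LTree ar} (h : IsMaxSubtree t w) : w.leaves ⊆ t.leaves := by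
  induction h with
  | refl t => exact subset_rfl
  | child i _ ih => exact ih.trans (leaves_child_subset _ i)

theorem size_le {t w : LTree ar} (h : IsMaxSubtree t w) : w.size ≤ t.size := by
  induction h with
  | refl t => exact le_rfl
  | child i _ ih => exact ih.trans (size_child_lt _ i).le

theorem isShuffle {t w : LTree ar} (h : IsMaxSubtree t w) (ht : t.IsShuffle) : w.IsShuffle := by
  induction h with
  | refl t => exact ht
  | child i _ ih => exact ih (ht.1 i)

theorem graft (s : ℕ → LTree ar) {t w : LTree ar} (h : IsMaxSubtree t w) :
    IsMaxSubtree (t.graft s) (w.graft s) := by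
  induction h with
  | refl t => exact .refl _
  | child i _ ih => exact .child i ih

theorem leaf_of_mem {x : ℕ} : ∀ {t : LTree ar}, x ∈ t.leaves → IsMaxSubtree t (leaf x)
  | leaf i, h => by
    obtain rfl : x = i := by simpa [leaves] using h
    exact .refl _
  | node b ch, h => by
    obtain ⟨i, hi⟩ := mem_leaves_node.1 h
    exact .child i (leaf_of_mem hi)

/-- The subtrees of a grafting `t.graft s` are those of the `s j` and those rooted at vertices
of `t`. -/
theorem of_graft {s : ℕ → LTree ar} {w t : LTree ar} (h : IsMaxSubtree (t.graft s) w) :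
    (∃ j ∈ t.leaves, IsMaxSubtree (s j) w) ∨
      ∃ b ch, IsMaxSubtree t (node b ch) ∧ w = (node b ch).graft s := by
  induction t with
  | leaf j => exact .inl ⟨j, by simp [leaves], h⟩
  | node b ch ih =>
    generalize ht : (node b ch).graft s = t' at h
    cases h with
    | refl => exact .inr ⟨b, ch, .refl _, ht.symm⟩
    | child i h =>
      simp only [LTree.graft, node.injEq] at ht
      obtain ⟨rfl, ht⟩ := ht
      obtain rfl := eq_of_heq ht
      obtain ⟨j, hj, hw⟩ | ⟨b', ch', hw, hw'⟩ := ih i h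
      · exact .inl ⟨j, leaves_child_subset ch i hj, hw⟩
      · exact .inr ⟨b', ch', .child i hw, hw'⟩

end IsMaxSubtree

namespace IsTop

theorem refl : ∀ t : LTree ar, IsTop t t
  | leaf x => by simpa using IsTop.cut (leaf x : LTree ar)
  | LTree.node b ch => .node b ch ch fun i => refl (ch i)

theorem leaves_subset {t u : LTree ar} (h : IsTop t u) : u.leaves ⊆ t.leaves := by
  induction h with
  | cut t => simpa [leaves] using minLeaf_mem t
  | node b ch ch' _ ih =>
    intro x hx
    obtain ⟨i, hi⟩ := mem_leaves_node.1 hx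
    exact mem_leaves_node.2 ⟨i, ih i hi⟩

theorem minLeaf_eq {t u : LTree ar} (h : IsTop t u) : u.minLeaf = t.minLeaf := by
  refine le_antisymm ?_ (minLeaf_le (h.leaves_subset (minLeaf_mem u)))
  induction h with
  | cut t => simp
  | node b ch ch' _ ih =>
    obtain ⟨i, hi⟩ := mem_leaves_node.1 (minLeaf_mem (LTree.node b ch))
    exact (minLeaf_le (mem_leaves_node.2 ⟨i, minLeaf_mem (ch' i)⟩)).trans
      ((ih i).trans (minLeaf_le hi))

theorem isShuffle {t u : LTree ar} (h : IsTop t u) (ht : t.IsShuffle) : u.IsShuffle := by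
  induction h with
  | cut t => trivial
  | node b ch ch' h ih =>
    refine ⟨fun i => ih i (ht.1 i), fun i j hij => ?_, fun i j hij => ?_⟩
    · exact Finset.disjoint_of_subset_left (h i).leaves_subset
        (Finset.disjoint_of_subset_right (h j).leaves_subset (ht.2.1 i j hij))
    · rw [(h i).minLeaf_eq, (h j).minLeaf_eq]
      exact ht.2.2 i j hij

theorem graft {s : ℕ → LTree ar} {t u : LTree ar} (h : IsTop t u)
    (hs : StrictMonoOn (fun j => (s j).minLeaf) (t.leaves : Set ℕ)) :
    IsTop (t.graft s) (u.relabel fun j => (s j).minLeaf) := by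
  induction h with
  | cut t => simpa [relabel, minLeaf_graft hs] using IsTop.cut (t.graft s)
  | node b ch ch' h ih =>
    exact .node b _ _ fun i => ih i (hs.mono (Finset.coe_subset.2 (leaves_child_subset ch i)))

/-- A tree is recovered from a truncation by grafting the subtrees that were cut off. -/
theorem exists_graft_eq {t u : LTree ar} (h : IsTop t u) (ht : t.IsShuffle) :
    ∃ s : ℕ → LTree ar, u.graft s = t ∧ (∀ j ∈ u.leaves, (s j).IsShuffle) ∧
      (∀ j ∈ u.leaves, (s j).minLeaf = j) ∧
      ∀ j ∈ u.leaves, ∀ j' ∈ u.leaves, j ≠ j' → Disjoint (s j).leaves (s j').leaves := by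
  classical
  induction h with
  | cut t =>
    refine ⟨fun _ => t, rfl, fun _ _ => ht, ?_, ?_⟩
    · simp [leaves]
    · intro j hj j' hj' hne
      simp only [leaves, Finset.mem_singleton] at hj hj'
      exact absurd (hj.trans hj'.symm) hne
  | node b ch ch' h ih =>
    choose s hs hsh hmin hd using fun i => ih i (ht.1 i)
    have hdis : ∀ i l x, x ∈ (ch' i).leaves → x ∈ (ch' l).leaves → i = l := by
      intro i l x hi hl
      by_contra hne
      exact Finset.disjoint_left.1 ((isShuffle (.node b ch ch' h) ht).2.1 i l hne) hi hl
    let S : ℕ → LTree ar := fun x => if hx : ∃ i, x ∈ (ch' i).leaves then s hx.choose x else leaf x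
    have hS : ∀ i x, x ∈ (ch' i).leaves → S x = s i x := by
      intro i x hx
      have hex : ∃ i, x ∈ (ch' i).leaves := ⟨i, hx⟩
      simp only [S, hex, dif_pos, hdis _ _ _ hex.choose_spec hx]
    have hsub : ∀ i x, x ∈ (ch' i).leaves → (s i x).leaves ⊆ (ch i).leaves := by
      intro i x hx y hy
      rw [← hs i]
      exact (mem_leaves_graft _ _ _).2 ⟨x, hx, hy⟩
    refine ⟨S, ?_, ?_, ?_, ?_⟩
    · simp only [LTree.graft]
      congr 1
      funext i
      rw [← hs i]
      exact graft_congr (hS i)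
    · intro j hj
      obtain ⟨i, hi⟩ := mem_leaves_node.1 hj
      rw [hS i j hi]
      exact hsh i j hi
    · intro j hj
      obtain ⟨i, hi⟩ := mem_leaves_node.1 hj
      rw [hS i j hi]
      exact hmin i j hi
    · intro j hj j' hj' hne
      obtain ⟨i, hi⟩ := mem_leaves_node.1 hj
      obtain ⟨i', hi'⟩ := mem_leaves_node.1 hj'
      rw [hS i j hi, hS i' j' hi']
      by_cases hii : i = i'
      · subst hii
        exact hd i j hi j' hi' hne
      · exact Finset.disjoint_of_subset_left (hsub i j hi)
          (Finset.disjoint_of_subset_right (hsub i' j' hi') (ht.2.1 i i' hii))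

end IsTop

/-- Cutting off the single subtree `w` of `t`. -/
theorem IsMaxSubtree.exists_isTop {t w : LTree ar} (h : IsMaxSubtree t w) (ht : t.IsShuffle) :
    ∃ u, IsTop t u ∧ u.graft (Function.update leaf w.minLeaf w) = t ∧ w.minLeaf ∈ u.leaves ∧
      ∀ x ∈ u.leaves, x ∈ w.leaves → x = w.minLeaf := by
  induction h with
  | refl t =>
    exact ⟨leaf t.minLeaf, .cut t, by simp [LTree.graft], by simp [leaves], by simp [leaves]⟩
  | @child b ch w i hw ih =>
    obtain ⟨u, hu, hg, hmem, hx⟩ := ih (ht.1 i)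
    have hne : ∀ l, l ≠ i → ∀ x ∈ (ch l).leaves, x ∉ w.leaves := fun l hl x hx hxw =>
      Finset.disjoint_left.1 (ht.2.1 l i hl) hx (hw.leaves_subset hxw)
    refine ⟨node b (Function.update ch i u), .node b _ _ fun l => ?_, ?_, ?_, ?_⟩
    · by_cases hl : l = i
      · subst hl; simpa using hu
      · simpa [hl] using IsTop.refl (ch l)
    · simp only [LTree.graft]
      congr 1
      funext l
      by_cases hl : l = i
      · subst hl; simpa using hg
      · rw [Function.update_of_ne hl]
        refine (graft_congr fun j hj => ?_).trans (graft_leaf (ch l))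
        rw [Function.update_of_ne]
        rintro rfl
        exact hne l hl _ hj (minLeaf_mem w)
    · exact mem_leaves_node.2 ⟨i, by simpa using hmem⟩
    · intro x hxu hxw
      obtain ⟨l, hl⟩ := mem_leaves_node.1 hxu
      by_cases hli : l = i
      · subst hli
        exact hx x (by simpa using hl) hxw
      · rw [Function.update_of_ne hli] at hl
        exact absurd hxw (hne l hli x hl)

theorem Divides.of_isMaxSubtree {d t t' : LTree ar} (h : d.Divides t') (ht : IsMaxSubtree t t') :
    d.Divides t := by
  obtain ⟨w, u, hw, hu, h⟩ := h
  exact ⟨w, u, ht.trans hw, hu, h⟩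

theorem isMaxSubtree_graft {s : ℕ → LTree ar} {t : LTree ar} {j : ℕ} (hj : j ∈ t.leaves) :
    IsMaxSubtree (t.graft s) (s j) :=
  (IsMaxSubtree.leaf_of_mem hj).graft s

/-- Divisors of `t` divide the graftings onto `t` that keep the order of the smallest leaves. -/
theorem Divides.graft {d t : LTree ar} {s : ℕ → LTree ar} (h : d.Divides t)
    (hs : StrictMonoOn (fun j => (s j).minLeaf) (t.leaves : Set ℕ)) :
    d.Divides (t.graft s) := by
  obtain ⟨w, u, hw, hu, σ, hσ, rfl⟩ := h
  have hs' := hs.mono (Finset.coe_subset.2 hw.leaves_subset)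
  have hs'' := hs'.mono (Finset.coe_subset.2 hu.leaves_subset)
  set μ : ℕ → ℕ := fun j => (s j).minLeaf with hμ
  have hinv : ∀ j ∈ u.leaves, Function.invFunOn μ (u.leaves : Set ℕ) (s j).minLeaf = j :=
    fun j hj => hs''.injOn.leftInvOn_invFunOn hj
  refine ⟨_, _, hw.graft s, hu.graft hs', σ ∘ Function.invFunOn μ (u.leaves : Set ℕ), ?_, ?_⟩
  · intro x hx y hy hxy
    rw [leaves_relabel] at hx hy
    obtain ⟨j, hj, rfl⟩ := Finset.mem_image.1 hx
    obtain ⟨j', hj', rfl⟩ := Finset.mem_image.1 hy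
    simp only [Function.comp, hinv j hj, hinv j' hj']
    exact hσ hj hj' ((hs''.lt_iff_lt hj hj').1 hxy)
  · rw [relabel_eq_graft, graft_relabel, relabel_eq_graft]
    refine graft_congr fun j hj => ?_
    simp [hinv j hj]

/-! ### Nonsymmetric graftings and intervals -/

/-- The leaf sets of the trees `s j`, for `j ∈ A`, lie one after the other in increasing order:
grafting the `s j` is a composition along a nondecreasing surjection. -/
def AscendingOn (s : ℕ → LTree ar) (A : Finset ℕ) : Prop :=
  ∀ j ∈ A, ∀ j' ∈ A, j < j' → AllLT (s j).leaves (s j').leaves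

namespace AscendingOn

variable {s : ℕ → LTree ar} {A : Finset ℕ}

theorem mono {A' : Finset ℕ} (hs : AscendingOn s A) (h : A' ⊆ A) : AscendingOn s A' :=
  fun j hj j' hj' => hs j (h hj) j' (h hj')

theorem le_of_le (hs : AscendingOn s A) {j j' x y : ℕ} (hj : j ∈ A) (hj' : j' ∈ A)
    (hx : x ∈ (s j).leaves) (hy : y ∈ (s j').leaves) (hxy : x ≤ y) : j ≤ j' := by
  by_contra! h
  exact (hs j' hj' j hj h y hy x hx).not_ge hxy

theorem eq_of_mem (hs : AscendingOn s A) {j j' x : ℕ} (hj : j ∈ A) (hj' : j' ∈ A)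
    (hx : x ∈ (s j).leaves) (hx' : x ∈ (s j').leaves) : j = j' :=
  le_antisymm (hs.le_of_le hj hj' hx hx' le_rfl) (hs.le_of_le hj' hj hx' hx le_rfl)

theorem injOn (hs : AscendingOn s A) {j j' : ℕ} (hj : j ∈ A) (hj' : j' ∈ A) (h : s j = s j') :
    j = j' :=
  hs.eq_of_mem hj hj' (minLeaf_mem (s j)) (h ▸ minLeaf_mem (s j))

theorem disjoint (hs : AscendingOn s A) {j j' : ℕ} (hj : j ∈ A) (hj' : j' ∈ A) (h : j ≠ j') :
    Disjoint (s j).leaves (s j').leaves :=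
  Finset.disjoint_left.2 fun _ hx hx' => h (hs.eq_of_mem hj hj' hx hx')

theorem strictMonoOn (hs : AscendingOn s A) :
    StrictMonoOn (fun j => (s j).minLeaf) (A : Set ℕ) := fun j hj j' hj' h =>
  hs j hj j' hj' h _ (minLeaf_mem _) _ (minLeaf_mem _)

theorem blocks {t : LTree ar} (hs : AscendingOn s t.leaves) :
    Blocks AllLT t.leaves (fun j => (s j.1).leaves) (t.graft s).leaves where
  nonempty j := leaves_nonempty _
  disjoint j j' h := hs.disjoint j.2 j'.2 fun e => h (Subtype.ext e)
  mem_iff i := by simp [mem_leaves_graft]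
  order j j' h := hs j j.2 j' j'.2 h

theorem isShuffle_graft {t : LTree ar} (hs : AscendingOn s t.leaves) (ht : t.IsShuffle)
    (h : ∀ j ∈ t.leaves, (s j).IsShuffle) : (t.graft s).IsShuffle :=
  ht.graft h (fun _ hj _ hj' hne => hs.disjoint hj hj' hne)
    fun _ hj _ hj' hlt => hs.strictMonoOn hj hj' hlt

/-- A nonsymmetric grafting neither creates nor destroys intervals of leaves. -/
theorem isIntervalIn_graft_iff {p q : LTree ar} (hs : AscendingOn s p.leaves)
    (hq : q.leaves ⊆ p.leaves) :
    IsIntervalIn (q.graft s).leaves (p.graft s).leaves ↔ IsIntervalIn q.leaves p.leaves := by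
  constructor
  · intro h a ha b hb c hc hac hcb
    have := h _ ((mem_leaves_graft s _ q).2 ⟨a, ha, minLeaf_mem (s a)⟩)
      _ ((mem_leaves_graft s _ q).2 ⟨b, hb, minLeaf_mem (s b)⟩)
      _ ((mem_leaves_graft s _ p).2 ⟨c, hc, minLeaf_mem (s c)⟩)
      (hs.strictMonoOn (hq ha) hc hac) (hs.strictMonoOn hc (hq hb) hcb)
    obtain ⟨j, hj, hx⟩ := (mem_leaves_graft s _ q).1 this
    rwa [hs.eq_of_mem hc (hq hj) (minLeaf_mem _) hx]
  · intro h x hx y hy z hz hxz hzy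
    obtain ⟨a, ha, hx⟩ := (mem_leaves_graft s _ q).1 hx
    obtain ⟨b, hb, hy⟩ := (mem_leaves_graft s _ q).1 hy
    obtain ⟨c, hc, hz⟩ := (mem_leaves_graft s _ p).1 hz
    refine (mem_leaves_graft s _ q).2 ⟨c, ?_, hz⟩
    rcases (hs.le_of_le (hq ha) hc hx hz hxz.le).eq_or_lt with rfl | hac
    · exact ha
    rcases (hs.le_of_le hc (hq hb) hz hy hzy.le).eq_or_lt with rfl | hcb
    · exact hb
    exact h a ha b hb c hc hac hcb

theorem isIntervalIn_leaves {p : LTree ar} (hs : AscendingOn s p.leaves) {j : ℕ}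
    (hj : j ∈ p.leaves) : IsIntervalIn (s j).leaves (p.graft s).leaves := by
  refine (hs.isIntervalIn_graft_iff (q := leaf j) (by simpa [leaves] using hj)).2 ?_
  intro a ha b hb c _ hac hcb
  simp only [leaves, Finset.mem_singleton] at ha hb
  omega

end AscendingOn

theorem ascendingOn_leaf {σ : ℕ → ℕ} {A : Finset ℕ} (hσ : StrictMonoOn σ (A : Set ℕ)) :
    AscendingOn (fun j => (leaf (σ j) : LTree ar)) A := by
  intro j hj j' hj' h x hx y hy
  simp only [leaves, Finset.mem_singleton] at hx hy
  rw [hx, hy]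
  exact hσ hj hj' h

theorem isShuffle_relabel {t : LTree ar} (ht : t.IsShuffle) {σ : ℕ → ℕ}
    (hσ : StrictMonoOn σ (t.leaves : Set ℕ)) : (t.relabel σ).IsShuffle := by
  rw [relabel_eq_graft]
  exact (ascendingOn_leaf hσ).isShuffle_graft ht fun _ _ => trivial

theorem IsPrime.eq_node {t : LTree ar} (h : t.IsPrime) : ∃ b ch, t = node b ch := by
  cases t with
  | leaf => exact h.elim
  | node b ch => exact ⟨b, ch, rfl⟩

theorem isPrime_relabel_iff {t : LTree ar} {σ : ℕ → ℕ} (hσ : StrictMonoOn σ (t.leaves : Set ℕ)) :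
    (t.relabel σ).IsPrime ↔ t.IsPrime := by
  cases t with
  | leaf => rfl
  | node b ch =>
    have hs := ascendingOn_leaf (ar := ar) hσ
    have key : ∀ i b' ch', IsMaxSubtree (ch i) (node b' ch') →
        (IsIntervalIn ((node b' ch').graft fun j => leaf (σ j)).leaves
          ((node b ch).graft fun j => leaf (σ j)).leaves ↔
            IsIntervalIn (node b' ch').leaves (node b ch).leaves) := fun i b' ch' h =>
      hs.isIntervalIn_graft_iff (h.leaves_subset.trans (leaves_child_subset ch i))
    rw [relabel_eq_graft]
    constructor
    · intro h i b' ch' hw hint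
      exact h i b' _ (hw.graft _) ((key i b' ch' hw).2 hint)
    · intro h i b' ch' hw hint
      obtain ⟨j, _, hj⟩ | ⟨b'', ch'', hw', he⟩ := hw.of_graft
      · cases hj
      · rw [he] at hint
        exact h i b'' ch'' hw' ((key i b'' ch'' hw').1 hint)

/-! ### Factorization of tree monomials into prime ones -/

/-- A presentation of `t` as a nonsymmetric composition of a prime tree monomial, with leaves
labelled by `0, …, arity - 1`, and of further trees. The values of `branch` outside of this range
play no role. -/
structure PrimeFactorization (t : LTree ar) where
  arity : ℕ
  head : LTree ar
  branch : ℕ → LTree ar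
  isPrime_head : head.IsPrime
  isShuffle_head : head.IsShuffle
  leaves_head : head.leaves = Finset.range arity
  ascendingOn : AscendingOn branch head.leaves
  isShuffle_branch : ∀ j ∈ head.leaves, (branch j).IsShuffle
  graft_eq : head.graft branch = t

/-- The vertices of the prime head are the vertices of the total tree that are not below the root of
a branch, hence the head is determined up to its leaf labels. Here `q` and `q'` run through
corresponding subtrees of two heads `p` and `p'`. -/
theorem eq_relabel_of_graft_eq_graft {p p' : LTree ar} {s s' : ℕ → LTree ar} {τ : ℕ → ℕ}
    (hs : AscendingOn s p.leaves) (hs' : AscendingOn s' p'.leaves) (hp : p.graft s = p'.graft s')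
    (hτ : ∀ j ∈ p.leaves, ∀ j' ∈ p'.leaves, s j = s' j' → τ j = j') :
    ∀ {q q' : LTree ar}, q.leaves ⊆ p.leaves → q'.leaves ⊆ p'.leaves →
      (∀ b ch, IsMaxSubtree q (node b ch) → ¬ IsIntervalIn (node b ch).leaves p.leaves) →
      (∀ b ch, IsMaxSubtree q' (node b ch) → ¬ IsIntervalIn (node b ch).leaves p'.leaves) →
      q.graft s = q'.graft s' → q' = q.relabel τ ∧ ∀ j ∈ q.leaves, s j = s' (τ j) := by
  intro q
  induction q with
  | leaf j =>
    intro q' hq hq' _ hn' h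
    have hj : j ∈ p.leaves := hq (by simp [leaves])
    cases q' with
    | leaf j' =>
      have hj' : j' ∈ p'.leaves := hq' (by simp [leaves])
      have e := hτ j hj j' hj' h
      refine ⟨by rw [relabel, e], ?_⟩
      simp only [leaves, Finset.mem_singleton, forall_eq, e]
      exact h
    | node b' ch' =>
      refine absurd ((hs'.isIntervalIn_graft_iff hq').1 ?_) (hn' b' ch' (.refl _))
      rw [← h, ← hp]
      exact hs.isIntervalIn_leaves hj
  | node b ch ih =>
    intro q' hq hq' hn hn' h
    cases q' with
    | leaf j' =>
      have hj' : j' ∈ p'.leaves := hq' (by simp [leaves])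
      refine absurd ((hs.isIntervalIn_graft_iff hq).1 ?_) (hn b ch (.refl _))
      rw [h, hp]
      exact hs'.isIntervalIn_leaves hj'
    | node b' ch' =>
      simp only [graft, node.injEq] at h
      obtain ⟨rfl, h⟩ := h
      have key := fun i => ih i ((leaves_child_subset ch i).trans hq)
        ((leaves_child_subset ch' i).trans hq') (fun b'' ch'' hw => hn b'' ch'' (.child i hw))
        (fun b'' ch'' hw => hn' b'' ch'' (.child i hw)) (congrFun (eq_of_heq h) i)
      refine ⟨?_, fun j hj => ?_⟩
      · simp only [relabel]
        congr 1
        funext i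
        exact (key i).1
      · obtain ⟨i, hi⟩ := mem_leaves_node.1 hj
        exact (key i).2 j hi

theorem strictMonoOn_range_eq_id {n m : ℕ} {τ : ℕ → ℕ}
    (hτ : StrictMonoOn τ (Finset.range n : Set ℕ))
    (h : (Finset.range n).image τ = Finset.range m) : n = m ∧ ∀ j < n, τ j = j := by
  have hnm : n = m := by
    rw [← Finset.card_range m, ← h, Finset.card_image_of_injOn hτ.injOn, Finset.card_range]
  subst hnm
  refine ⟨rfl, fun j hj => ?_⟩
  have e : (fun i : Fin n => τ i) = fun i : Fin n => (i : ℕ) := by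
    have hf : StrictMono fun i : Fin n => τ i := fun i i' hi => hτ (by simp) (by simp) hi
    refine (hf.range_inj Fin.val_strictMono).1 ?_
    ext x
    have := congrArg (x ∈ ·) h
    simp only [Finset.mem_image, Finset.mem_range, eq_iff_iff] at this
    simp only [Set.mem_range]
    constructor
    · rintro ⟨i, rfl⟩
      exact ⟨⟨τ i, this.1 ⟨i, i.2, rfl⟩⟩, rfl⟩
    · rintro ⟨i, rfl⟩
      obtain ⟨a, ha, e⟩ := this.2 i.2
      exact ⟨⟨a, ha⟩, e⟩
  exact congrFun e ⟨j, hj⟩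

namespace PrimeFactorization

theorem mem_head {t : LTree ar} (F : PrimeFactorization t) {j : ℕ} :
    j ∈ F.head.leaves ↔ j < F.arity := by
  rw [F.leaves_head, Finset.mem_range]

theorem not_leaf {x : ℕ} (F : PrimeFactorization (leaf x : LTree ar)) : False := by
  obtain ⟨b, ch, h⟩ := F.isPrime_head.eq_node
  have := F.graft_eq
  rw [h] at this
  cases this

/-- The two heads have the same shape, and the resulting correspondence `τ` of their leaves
preserves the order, as the branches at corresponding leaves are equal. -/
theorem unique {t : LTree ar} (F F' : PrimeFactorization t) :
    F.arity = F'.arity ∧ F.head = F'.head ∧ ∀ j < F.arity, F.branch j = F'.branch j := by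
  classical
  obtain ⟨b, ch, hb⟩ := F.isPrime_head.eq_node
  obtain ⟨b', ch', hb'⟩ := F'.isPrime_head.eq_node
  have hp : F.head.graft F.branch = F'.head.graft F'.branch := F.graft_eq.trans F'.graft_eq.symm
  let τ : ℕ → ℕ := fun j =>
    if h : ∃ j' ∈ F'.head.leaves, F.branch j = F'.branch j' then h.choose else 0
  have hτ : ∀ j ∈ F.head.leaves, ∀ j' ∈ F'.head.leaves, F.branch j = F'.branch j' → τ j = j' := by
    intro j _ j' hj' h
    have hex : ∃ j' ∈ F'.head.leaves, F.branch j = F'.branch j' := ⟨j', hj', h⟩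
    simp only [τ, hex, dif_pos]
    exact F'.ascendingOn.injOn hex.choose_spec.1 hj' (hex.choose_spec.2.symm.trans h)
  have key : F'.head = F.head.relabel τ ∧ ∀ j ∈ F.head.leaves, F.branch j = F'.branch (τ j) := by
    have aux := @eq_relabel_of_graft_eq_graft _ _ _ _ _ _ _ F.ascendingOn F'.ascendingOn hp hτ
    have hpr := F.isPrime_head
    have hpr' := F'.isPrime_head
    rw [hb] at aux hp hpr ⊢
    rw [hb'] at aux hp hpr' ⊢
    simp only [LTree.graft, node.injEq] at hp
    obtain ⟨rfl, hp⟩ := hp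
    have hi := fun i => aux (leaves_child_subset ch i) (leaves_child_subset ch' i) (hpr i) (hpr' i)
      (congrFun (eq_of_heq hp) i)
    refine ⟨?_, fun j hj => ?_⟩
    · simp only [relabel]
      congr 1
      funext i
      exact (hi i).1
    · obtain ⟨i, hji⟩ := mem_leaves_node.1 hj
      exact (hi i).2 j hji
  have himg : (Finset.range F.arity).image τ = Finset.range F'.arity := by
    rw [← F.leaves_head, ← F'.leaves_head, key.1, leaves_relabel]
  have hτmem : ∀ j ∈ F.head.leaves, τ j ∈ F'.head.leaves := fun j hj => by
    rw [key.1, leaves_relabel]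
    exact Finset.mem_image_of_mem τ hj
  have hmono : StrictMonoOn τ (Finset.range F.arity : Set ℕ) := by
    rw [← F.leaves_head]
    intro j hj j' hj' hlt
    by_contra! hle
    have h1 := F.ascendingOn j hj j' hj' hlt _ (minLeaf_mem _) _ (minLeaf_mem _)
    rw [key.2 j hj, key.2 j' hj'] at h1
    exact h1.not_ge (F'.ascendingOn.strictMonoOn.monotoneOn (hτmem _ hj') (hτmem _ hj) hle)
  obtain ⟨hn, hid⟩ := strictMonoOn_range_eq_id hmono himg
  refine ⟨hn, ?_, fun j hj => ?_⟩
  · rw [key.1, relabel_eq_graft]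
    conv_lhs => rw [← graft_leaf F.head]
    exact graft_congr fun j hj => by rw [hid j (F.mem_head.1 hj)]
  · rw [key.2 j (F.mem_head.2 hj), hid j hj]

theorem leaves_branch_subset {t : LTree ar} (F : PrimeFactorization t) {j : ℕ}
    (hj : j ∈ F.head.leaves) : (F.branch j).leaves ⊆ t.leaves := fun x hx => by
  have : x ∈ (F.head.graft F.branch).leaves := (mem_leaves_graft _ _ _).2 ⟨j, hj, hx⟩
  rwa [F.graft_eq] at this

/-- A nonsymmetric grafting onto `t` amounts to graftings onto the branches of `t`. -/
def graft {t : LTree ar} (F : PrimeFactorization t) {s : ℕ → LTree ar}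
    (hs : AscendingOn s t.leaves) (hsh : ∀ j ∈ t.leaves, (s j).IsShuffle) :
    PrimeFactorization (t.graft s) :=
  { arity := F.arity
    head := F.head
    branch := fun j => (F.branch j).graft s
    isPrime_head := F.isPrime_head
    isShuffle_head := F.isShuffle_head
    leaves_head := F.leaves_head
    ascendingOn := by
      intro j hj j' hj' hlt x hx y hy
      obtain ⟨a, ha, hx⟩ := (mem_leaves_graft s _ _).1 hx
      obtain ⟨b, hb, hy⟩ := (mem_leaves_graft s _ _).1 hy
      exact hs a (F.leaves_branch_subset hj ha) b (F.leaves_branch_subset hj' hb)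
        (F.ascendingOn j hj j' hj' hlt a ha b hb) x hx y hy
    isShuffle_branch := fun j hj => (hs.mono (F.leaves_branch_subset hj)).isShuffle_graft
      (F.isShuffle_branch j hj) fun i hi => hsh i (F.leaves_branch_subset hj hi)
    graft_eq := by rw [← graft_graft, F.graft_eq] }

theorem size_branch_lt {t : LTree ar} (F : PrimeFactorization t) {j : ℕ} (hj : j ∈ F.head.leaves) :
    (F.branch j).size < t.size := by
  have := size_add_size_le_size_graft F.branch hj
  rw [F.graft_eq] at this
  obtain ⟨b, ch, h⟩ := F.isPrime_head.eq_node
  rw [h] at this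
  simp only [size] at this
  omega

theorem blocks {t : LTree ar} (F : PrimeFactorization t) :
    Blocks AllLT (Finset.range F.arity) (fun j => (F.branch j.1).leaves) t.leaves := by
  have := F.ascendingOn.blocks
  rwa [F.graft_eq, F.leaves_head] at this

theorem nonempty_of_isPrime {t : LTree ar} (ht : t.IsShuffle) (hp : t.IsPrime) :
    Nonempty (PrimeFactorization t) := by
  classical
  -- the rank of `x` among the leaves of `t`
  let σ : ℕ → ℕ := fun x => (t.leaves.filter (· < x)).card
  have hσ : StrictMonoOn σ (t.leaves : Set ℕ) := by
    intro x hx y _ hxy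
    refine Finset.card_lt_card ⟨fun z hz => ?_, fun h => ?_⟩
    · rw [Finset.mem_filter] at hz ⊢
      exact ⟨hz.1, hz.2.trans hxy⟩
    · have := h (Finset.mem_filter.2 ⟨hx, hxy⟩)
      exact lt_irrefl x (Finset.mem_filter.1 this).2
  have himg : t.leaves.image σ = Finset.range t.leaves.card := by
    refine Finset.eq_of_subset_of_card_le (fun x hx => ?_) ?_
    · obtain ⟨y, hy, rfl⟩ := Finset.mem_image.1 hx
      refine Finset.mem_range.2 (Finset.card_lt_card ⟨Finset.filter_subset _ _, fun h => ?_⟩)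
      exact lt_irrefl y (Finset.mem_filter.1 (h hy)).2
    · rw [Finset.card_image_of_injOn hσ.injOn, Finset.card_range]
  have hinv : ∀ j ∈ t.leaves, Function.invFunOn σ (t.leaves : Set ℕ) (σ j) = j := fun j hj =>
    hσ.injOn.leftInvOn_invFunOn hj
  refine ⟨⟨t.leaves.card, t.relabel σ, fun j => leaf (Function.invFunOn σ (t.leaves : Set ℕ) j),
    (isPrime_relabel_iff hσ).2 hp, isShuffle_relabel ht hσ, by rw [leaves_relabel, himg], ?_,
    fun _ _ => trivial, ?_⟩⟩
  · refine ascendingOn_leaf fun x hx y hy hxy => ?_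
    rw [leaves_relabel] at hx hy
    obtain ⟨j, hj, rfl⟩ := Finset.mem_image.1 hx
    obtain ⟨j', hj', rfl⟩ := Finset.mem_image.1 hy
    rw [hinv j hj, hinv j' hj']
    exact (hσ.lt_iff_lt hj hj').1 hxy
  · rw [graft_relabel]
    refine (graft_congr fun j hj => ?_).trans (graft_leaf t)
    rw [hinv j hj]

/-- If the tree is not prime, some proper subtree `w` with a root vertex has an interval as its set
of leaves. A factorization of what remains after cutting off `w` then gives one of the whole tree,
since grafting `w` back is a nonsymmetric composition. -/
theorem nonempty {b : B} {ch : Fin (ar b : ℕ) → LTree ar} (ht : (node b ch).IsShuffle) :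
    Nonempty (PrimeFactorization (node b ch)) := by
  generalize hn : (node b ch).size = n
  induction n using Nat.strong_induction_on generalizing b ch with
  | _ n ih =>
    by_cases hp : (node b ch).IsPrime
    · exact nonempty_of_isPrime ht hp
    simp only [IsPrime, not_forall, not_not] at hp
    obtain ⟨i, b', ch', hw, hint⟩ := hp
    generalize hw' : node b' ch' = w at hw hint
    have hwt : IsMaxSubtree (node b ch) w := .child i hw
    have hlt : w.size < (node b ch).size := hw.size_le.trans_lt (size_child_lt ch i)
    obtain ⟨u, hu, hg, hmem, hx⟩ := hwt.exists_isTop ht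
    cases u with
    | leaf y =>
      obtain rfl : w.minLeaf = y := by simpa [leaves] using hmem
      simp only [LTree.graft, Function.update_self] at hg
      exact absurd (congrArg size hg) hlt.ne
    | node b'' ch'' =>
      have hsize := size_add_size_le_size_graft (Function.update leaf w.minLeaf w) hmem
      rw [hg, Function.update_self] at hsize
      have hpos : 0 < w.size := by rw [← hw']; simp only [size]; omega
      obtain ⟨F⟩ := ih _ (by omega) (hu.isShuffle ht) rfl
      have hlv : ∀ j, j ≠ w.minLeaf → ∀ x,
          x ∈ (Function.update leaf w.minLeaf w j : LTree ar).leaves → x = j := by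
        intro j hj x hxj
        simpa [hj, leaves] using hxj
      have hasc : AscendingOn (Function.update leaf w.minLeaf w) (node b'' ch'').leaves := by
        intro j hj j' hj' hjj x hxj y hyj
        by_cases h : j = w.minLeaf
        · obtain rfl := hlv j' (by omega) y hyj
          rw [h, Function.update_self] at hxj
          -- otherwise `y` would lie between `min w` and `x`, hence be a second leaf of `u` in `w`
          by_contra! hle
          have hyw : y ∈ w.leaves := by
            rcases hle.eq_or_lt with rfl | hlt'
            · exact hxj
            · exact hint _ (minLeaf_mem w) x hxj y (hu.leaves_subset hj') (by omega) hlt'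
          have := hx y hj' hyw
          omega
        · obtain rfl := hlv j h x hxj
          by_cases h' : j' = w.minLeaf
          · rw [h', Function.update_self] at hyj
            have := minLeaf_le hyj
            omega
          · obtain rfl := hlv j' h' y hyj
            exact hjj
      rw [← hg]
      refine ⟨F.graft hasc fun j _ => ?_⟩
      by_cases h : j = w.minLeaf
      · rw [h, Function.update_self]
        exact hwt.isShuffle ht
      · rw [Function.update_of_ne h]
        trivial

/-- Truncations `v` of a nonsymmetric grafting `q.graft s` that have no vertex on an interval of
leaves do not reach into the trees `s j`. Here `q` runs through subtrees of a tree whose grafting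
has leaf set `T`, and `U` is the leaf set of the truncation containing `v`. -/
theorem _root_.LTree.IsTop.exists_of_graft {s : ℕ → LTree ar} {T U : Finset ℕ} (hUT : U ⊆ T) :
    ∀ {q v : LTree ar}, AscendingOn s q.leaves → (q.graft s).IsShuffle →
      (∀ j ∈ q.leaves, IsIntervalIn (s j).leaves T) →
      IsTop (q.graft s) v → (∀ c ∈ U, c ∈ (q.graft s).leaves → c ∈ v.leaves) → v.leaves ⊆ U →
      (∀ b ch, IsMaxSubtree v (node b ch) → ¬ IsIntervalIn (node b ch).leaves U) →
      ∃ v', IsTop q v' ∧ v = v'.relabel fun j => (s j).minLeaf := by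
  intro q
  induction q with
  | leaf j =>
    intro v _ _ hint hv hU hvU hn
    cases v with
    | leaf x =>
      refine ⟨leaf j, .refl _, ?_⟩
      have := hv.minLeaf_eq
      rw [minLeaf_leaf] at this
      rw [this]
      rfl
    | node b ch =>
      refine absurd (fun x hx y hy z hz hxz hzy => hU z hz ?_) (hn b ch (.refl _))
      exact hint j (by simp [leaves]) x (hv.leaves_subset hx) y (hv.leaves_subset hy) z (hUT hz)
        hxz hzy
  | node b ch ih =>
    intro v hs hsh hint hv hU hvU hn
    generalize ht : (node b ch).graft s = t at hv
    cases hv with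
    | cut t =>
      refine ⟨leaf (node b ch).minLeaf, .cut _, ?_⟩
      rw [← ht, minLeaf_graft hs.strictMonoOn]
      rfl
    | node b₁ ch₁ ch' h =>
      simp only [LTree.graft, node.injEq] at ht
      obtain ⟨rfl, ht⟩ := ht
      obtain rfl := eq_of_heq ht
      have key : ∀ i, ∃ v', IsTop (ch i) v' ∧ ch' i = v'.relabel fun j => (s j).minLeaf := by
        intro i
        refine ih i (hs.mono (leaves_child_subset ch i)) (hsh.1 i)
          (fun j hj => hint j (leaves_child_subset ch i hj)) (h i) ?_
          ((leaves_child_subset ch' i).trans hvU) fun b'' ch'' hw => hn b'' ch'' (.child i hw)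
        intro c hc hci
        obtain ⟨l, hl⟩ := mem_leaves_node.1 (hU c hc (leaves_child_subset
          (fun i => (ch i).graft s) i hci))
        by_cases hil : i = l
        · rwa [hil]
        · exact absurd ((h l).leaves_subset hl) (Finset.disjoint_left.1 (hsh.2.1 i l hil) hci)
      choose v' hv' he using key
      refine ⟨.node b v', .node b _ _ hv', ?_⟩
      simp only [relabel]
      congr 1
      funext i
      exact he i

/-- A prime divisor of `t` divides the head or a branch: a subtree with a vertex in the head and a
vertex in a branch is not prime, since the leaves above the root of the branch form an interval. -/
theorem divides_iff {t d : LTree ar} (F : PrimeFactorization t) (ht : t.IsShuffle)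
    (hd : d.IsPrime) :
    d.Divides t ↔ d.Divides F.head ∨ ∃ j ∈ F.head.leaves, d.Divides (F.branch j) := by
  constructor
  · rintro ⟨w, u, hw, hu, σ, hσ, rfl⟩
    have hup : u.IsPrime := (isPrime_relabel_iff hσ).1 hd
    have hwsh := hw.isShuffle ht
    rw [← F.graft_eq] at hw
    obtain ⟨j, hj, hw'⟩ | ⟨b, ch, hq, rfl⟩ := hw.of_graft
    · exact .inr ⟨j, hj, w, u, hw', hu, σ, hσ, rfl⟩
    · left
      have hs : AscendingOn F.branch (node b ch).leaves := F.ascendingOn.mono hq.leaves_subset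
      have hut : u.leaves ⊆ t.leaves := by
        rw [← F.graft_eq]
        exact hu.leaves_subset.trans hw.leaves_subset
      have hint : ∀ j ∈ (node b ch).leaves, IsIntervalIn (F.branch j).leaves t.leaves := by
        intro j hj
        have := F.ascendingOn.isIntervalIn_leaves (hq.leaves_subset hj)
        rwa [F.graft_eq] at this
      generalize hx : (node b ch).graft F.branch = x at hu
      cases hu with
      | cut => exact hup.elim
      | node b₁ ch₁ ch' h =>
        simp only [LTree.graft, node.injEq] at hx
        obtain ⟨rfl, hx⟩ := hx
        obtain rfl := eq_of_heq hx
        have key : ∀ i, ∃ v', IsTop (ch i) v' ∧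
            ch' i = v'.relabel fun j => (F.branch j).minLeaf := by
          intro i
          refine IsTop.exists_of_graft hut (hs.mono (leaves_child_subset ch i)) (hwsh.1 i)
            (fun j hj => hint j (leaves_child_subset ch i hj)) (h i) ?_ (leaves_child_subset ch' i)
            (hup i)
          intro c hc hci
          obtain ⟨l, hl⟩ := mem_leaves_node.1 hc
          by_cases hil : i = l
          · rwa [hil]
          · exact absurd ((h l).leaves_subset hl) (Finset.disjoint_left.1 (hwsh.2.1 i l hil) hci)
        choose v' hv' he using key
        obtain rfl : ch' = fun i => (v' i).relabel fun j => (F.branch j).minLeaf := funext he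
        have hv : IsTop (LTree.node b ch) (LTree.node b v') := .node b _ _ hv'
        have hm := (hs.mono hv.leaves_subset).strictMonoOn
        refine ⟨_, _, hq, hv, σ ∘ fun j => (F.branch j).minLeaf, ?_, ?_⟩
        · intro x hx y hy hxy
          have hmem : ∀ x ∈ (LTree.node b v').leaves, (F.branch x).minLeaf ∈
              ((LTree.node b v').relabel fun j => (F.branch j).minLeaf).leaves := fun x hx => by
            rw [leaves_relabel]
            exact Finset.mem_image_of_mem _ hx
          exact hσ (hmem x hx) (hmem y hy) (hm hx hy hxy)
        · change _ = ((LTree.node b v').relabel fun j => (F.branch j).minLeaf).relabel σ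
          simp only [relabel_eq_graft, graft_graft]
          rfl
  · rintro (h | ⟨j, hj, h⟩)
    · rw [← F.graft_eq]
      exact h.graft F.ascendingOn.strictMonoOn
    · refine h.of_isMaxSubtree ?_
      have := isMaxSubtree_graft (s := F.branch) hj
      rwa [F.graft_eq] at this

end PrimeFactorization

end LTree

/-! ### Evaluation of tree monomials in a nonsymmetric operad -/

section Evaluation

variable {k : Type u} [Field k] {B : Type v} {ar : B → ℕ+}

theorem BlockOperad.comp_congr_branches {R : Finset ℕ → Finset ℕ → Prop}
    (Q : BlockOperad.{u, w} R k)
    (e : ∀ t : LTree ar, Q.obj t.leaves) {J I : Finset ℕ} {s s' : ℕ → LTree ar}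
    (hs : ∀ j ∈ J, s j = s' j) (h : Blocks R J (fun j => (s j.1).leaves) I)
    (h' : Blocks R J (fun j => (s' j.1).leaves) I) (a : Q.obj J) :
    Q.comp h a (fun j => e (s j.1)) = Q.comp h' a (fun j => e (s' j.1)) := by
  have aux : ∀ S S' : {j // j ∈ J} → LTree ar, S = S' →
      ∀ (h : Blocks R J (fun j => (S j).leaves) I) (h' : Blocks R J (fun j => (S' j).leaves) I),
        Q.comp h a (fun j => e (S j)) = Q.comp h' a (fun j => e (S' j)) := by
    rintro S _ rfl h h'
    rfl
  exact aux (fun j => s j.1) (fun j => s' j.1) (funext fun j => hs j.1 j.2) h h'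

theorem BlockOperad.unit_comp_branch {R : Finset ℕ → Finset ℕ → Prop} (Q : BlockOperad.{u, w} R k)
    (e : ∀ t : LTree ar, Q.obj t.leaves) {x : ℕ} {s : ℕ → LTree ar}
    (h : Blocks R {x} (fun j => (s j.1).leaves) (s x).leaves) :
    Q.comp h (Q.unit x) (fun j => e (s j.1)) = e (s x) := by
  have h' : Blocks R {x} (fun _ => (s x).leaves) (s x).leaves := by
    convert h with j
    exact (Finset.mem_singleton.1 j.2).symm
  rw [Q.comp_congr_branches e (s' := fun _ => s x) (by simp) h h']
  exact Q.unit_comp h' (e (s x))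

variable (Q : NSOperad.{u, w} k)
  (g : ∀ n, TreeMonomial ar (Finset.range n) → Q.obj (Finset.range n))

/-- By uniqueness of prime factorizations, the recursion for `NSOperad.evalTree` does not depend on
the choice of one. -/
theorem NSOperad.comp_branch_eq {t : LTree ar} (e : ∀ t : LTree ar, Q.obj t.leaves)
    (F F' : t.PrimeFactorization) :
    Q.comp F.blocks (g _ ⟨F.head, F.isShuffle_head, F.leaves_head⟩) (fun j => e (F.branch j.1))
      = Q.comp F'.blocks (g _ ⟨F'.head, F'.isShuffle_head, F'.leaves_head⟩)
        fun j => e (F'.branch j.1) := by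
  have hu := F.unique F'
  have hb := F.blocks
  have hb' := F'.blocks
  obtain ⟨n, p, s, hp, hsh, hl, hasc, hs, hg⟩ := F
  obtain ⟨n', p', s', hp', hsh', hl', hasc', hs', hg'⟩ := F'
  obtain ⟨h1, h2, h3⟩ := hu
  dsimp only at h1 h2 h3
  subst h1 h2
  exact Q.comp_congr_branches e (fun j hj => h3 j (Finset.mem_range.1 hj)) hb hb' _

open Classical in
/-- The extension to all trees of a family of values `g` on the tree monomials labelled by
`0, …, n - 1`, by recursion along prime factorizations. Only the values of `g` on prime tree
monomials matter, and the value is zero on trees that have a vertex but no prime factorization; there are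
none such among tree monomials. -/
noncomputable def NSOperad.evalTree : ∀ t : LTree ar, Q.obj t.leaves
  | .leaf x => Q.unit x
  | .node b ch =>
    if h : Nonempty (LTree.PrimeFactorization (.node b ch)) then
      Q.comp h.some.blocks (g _ ⟨h.some.head, h.some.isShuffle_head, h.some.leaves_head⟩)
        fun j => NSOperad.evalTree (h.some.branch j.1)
    else 0
termination_by t => t.size
decreasing_by exact h.some.size_branch_lt (h.some.mem_head.2 (Finset.mem_range.1 j.2))

theorem NSOperad.evalTree_leaf (x : ℕ) : Q.evalTree g (.leaf x) = Q.unit x := by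
  rw [evalTree]

theorem NSOperad.evalTree_eq {t : LTree ar} (F : t.PrimeFactorization) :
    Q.evalTree g t = Q.comp F.blocks (g _ ⟨F.head, F.isShuffle_head, F.leaves_head⟩)
      fun j => Q.evalTree g (F.branch j.1) := by
  cases t with
  | leaf x => exact F.not_leaf.elim
  | node b ch =>
    have hne : Nonempty (LTree.PrimeFactorization (.node b ch)) := ⟨F⟩
    rw [evalTree, dif_pos hne]
    exact Q.comp_branch_eq g _ _ _

/-- Evaluation of trees is compatible with nonsymmetric compositions: by associativity, grafting
onto a tree is grafting onto the branches of its prime factorization. -/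
theorem NSOperad.evalTree_graft {s : ℕ → LTree ar} : ∀ {t : LTree ar}, t.IsShuffle →
    ∀ (hs : LTree.AscendingOn s t.leaves), (∀ j ∈ t.leaves, (s j).IsShuffle) →
      Q.evalTree g (t.graft s) =
        Q.comp hs.blocks (Q.evalTree g t) fun j => Q.evalTree g (s j.1) := by
  intro t
  generalize hn : t.size = n
  induction n using Nat.strong_induction_on generalizing t with
  | _ n ih =>
    intro ht hs hsh
    cases t with
    | leaf x =>
      rw [evalTree_leaf]
      exact (Q.unit_comp_branch (Q.evalTree g) hs.blocks).symm
    | node b ch =>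
      obtain ⟨F⟩ := LTree.PrimeFactorization.nonempty ht
      rw [Q.evalTree_eq g (F.graft hs hsh), Q.evalTree_eq g F]
      have hmem : ∀ l : {l // l ∈ Finset.range F.arity}, l.1 ∈ F.head.leaves := fun l =>
        F.mem_head.2 (Finset.mem_range.1 l.2)
      have e : ∀ l : {l // l ∈ Finset.range F.arity}, Q.evalTree g ((F.branch l.1).graft s) = _ :=
        fun l => ih _ (hn ▸ F.size_branch_lt (hmem l)) rfl (F.isShuffle_branch l.1 (hmem l))
          (hs.mono (F.leaves_branch_subset (hmem l))) fun j hj =>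
            hsh j (F.leaves_branch_subset (hmem l) hj)
      rw [Q.assoc F.blocks hs.blocks (F.graft hs hsh).blocks
        (fun l j hj => F.leaves_branch_subset (hmem l) hj) fun l =>
          (hs.mono (F.leaves_branch_subset (hmem l))).blocks]
      congr 1
      funext l
      exact e l

/-- The value of `NSOperad.evalTree` on a tree monomial, as an element of the component of `Q` on
its set of leaf labels. -/
noncomputable def NSOperad.evalMonomial {I : Finset ℕ} (t : TreeMonomial ar I) : Q.obj I :=
  cast (congrArg Q.obj t.2.2) (Q.evalTree g t.1)

theorem NSOperad.evalMonomial_unit (x : ℕ) :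
    Q.evalMonomial g (TreeMonomial.unit x) = Q.unit x :=
  Q.evalTree_leaf g x

end Evaluation

/-- Every family of tree monomials indexed by `J` is the restriction of a family of trees indexed
by `ℕ`. -/
theorem TreeMonomial.exists_extend {B : Type v} {ar : B → ℕ+} {J : Finset ℕ}
    {K : {j // j ∈ J} → Finset ℕ} (s : ∀ j, TreeMonomial ar (K j)) :
    ∃ S : ℕ → LTree ar, ∀ j, (s j).1 = S j.1 := by
  refine ⟨fun j => if hj : j ∈ J then (s ⟨j, hj⟩).1 else .leaf j, fun j => ?_⟩
  simp

theorem TreeMonomial.ascendingOn {B : Type v} {ar : B → ℕ+} {J I : Finset ℕ}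
    {K : {j // j ∈ J} → Finset ℕ} (h : Blocks AllLT J K I) (s : ∀ j, TreeMonomial ar (K j))
    {S : ℕ → LTree ar} (hS : ∀ j, (s j).1 = S j.1) : LTree.AscendingOn S J := by
  intro j hj j' hj' hlt
  rw [← hS ⟨j, hj⟩, ← hS ⟨j', hj'⟩, (s ⟨j, hj⟩).2.2, (s ⟨j', hj'⟩).2.2]
  exact h.order ⟨j, hj⟩ ⟨j', hj'⟩ hlt

theorem TreeMonomial.graft_val {B : Type v} {ar : B → ℕ+} {J I : Finset ℕ}
    {K : {j // j ∈ J} → Finset ℕ} (h : Blocks MinLT J K I) (t : TreeMonomial ar J)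
    (s : ∀ j, TreeMonomial ar (K j)) {S : ℕ → LTree ar} (hS : ∀ j, (s j).1 = S j.1) :
    (TreeMonomial.graft h t s).1 = t.1.graft S := by
  refine LTree.graft_congr fun j hj => ?_
  rw [t.2.2] at hj
  rw [dif_pos hj, hS]

theorem NSOperad.evalMonomial_graft {k : Type u} [Field k] {B : Type v} {ar : B → ℕ+}
    (Q : NSOperad.{u, w} k) (g : ∀ n, TreeMonomial ar (Finset.range n) → Q.obj (Finset.range n))
    {J I : Finset ℕ} {K : {j // j ∈ J} → Finset ℕ} (h : Blocks AllLT J K I)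
    (t : TreeMonomial ar J) (s : ∀ j, TreeMonomial ar (K j)) :
    Q.evalMonomial g (TreeMonomial.graft h.minLT t s)
      = Q.comp h (Q.evalMonomial g t) fun j => Q.evalMonomial g (s j) := by
  obtain ⟨S, hS⟩ := TreeMonomial.exists_extend s
  have hasc := TreeMonomial.ascendingOn h s hS
  have hval := TreeMonomial.graft_val h.minLT t s hS
  generalize TreeMonomial.graft h.minLT t s = r at hval
  have hsh : ∀ j ∈ J, (S j).IsShuffle := fun j hj => hS ⟨j, hj⟩ ▸ (s ⟨j, hj⟩).2.1
  obtain ⟨t, ht, rfl⟩ := t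
  obtain ⟨_, hr, rfl⟩ := r
  obtain rfl : K = fun j => (S j.1).leaves := funext fun j => by rw [← hS, (s j).2.2]
  obtain rfl : s = fun j => ⟨S j.1, hsh j.1 j.2, rfl⟩ := funext fun j => Subtype.ext (hS j)
  dsimp only at hval
  subst hval
  exact Q.evalTree_graft g ht hasc hsh

/-! ### Normal monomials form a basis of the quotient -/

section NormalBasis

variable {k : Type u} [Field k] {B : Type v} {ar : B → ℕ+}

theorem freeComp_eq_mapDomain_left {J : Finset ℕ} {K : {j // j ∈ J} → Finset ℕ} {I : Finset ℕ}
    (h : Blocks MinLT J K I) (s : ∀ j, TreeMonomial ar (K j)) (f : TreeMonomial ar J →₀ k) :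
    freeComp k ar h f (fun j => Finsupp.single (s j) 1)
      = f.mapDomain fun t => TreeMonomial.graft h t s := by
  induction f using Finsupp.induction_linear with
  | zero => simp
  | add x y hx hy => rw [map_add, _root_.add_apply, hx, hy, Finsupp.mapDomain_add]
  | single t r =>
    rw [← mul_one r, ← smul_eq_mul, ← Finsupp.smul_single, map_smul, _root_.smul_apply,
      freeComp_single, Finsupp.mapDomain_smul, Finsupp.mapDomain_single]

theorem freeComp_eq_mapDomain_right {J : Finset ℕ} {K : {j // j ∈ J} → Finset ℕ} {I : Finset ℕ}
    (h : Blocks MinLT J K I) (t : TreeMonomial ar J) (s : ∀ j, TreeMonomial ar (K j))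
    (j₀ : {j // j ∈ J}) (f : TreeMonomial ar (K j₀) →₀ k) :
    freeComp k ar h (Finsupp.single t 1)
        (Function.update (fun j => Finsupp.single (s j) 1) j₀ f)
      = f.mapDomain fun r => TreeMonomial.graft h t (Function.update s j₀ r) := by
  induction f using Finsupp.induction_linear with
  | zero => simp
  | add x y hx hy => rw [MultilinearMap.map_update_add, hx, hy, Finsupp.mapDomain_add]
  | single r c =>
    have e : Function.update (fun j => (Finsupp.single (s j) 1 : TreeMonomial ar (K j) →₀ k)) j₀
        (Finsupp.single r 1) = fun j => Finsupp.single (Function.update s j₀ r j) 1 := by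
      funext j
      by_cases hj : j = j₀
      · subst hj; simp
      · simp [hj]
    rw [← mul_one c, ← smul_eq_mul, ← Finsupp.smul_single, MultilinearMap.map_update_smul, e,
      freeComp_single, Finsupp.mapDomain_smul, Finsupp.mapDomain_single]

namespace AdmissibleOrder

variable (o : AdmissibleOrder ar)

theorem exists_isLeadingTerm {I : Finset ℕ} {f : TreeMonomial ar I →₀ k} (hf : f ≠ 0) :
    ∃ t, o.IsLeadingTerm f t := by
  classical
  have := o.isWellOrder I
  let _ := linearOrderOfSTO (o.lt I)
  obtain ⟨t, ht, hmax⟩ := f.support.exists_max_image id (Finsupp.support_nonempty_iff.2 hf)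
  exact ⟨t, ht, fun t' ht' hne => lt_of_le_of_ne (hmax t' ht') hne⟩

variable {o}

/-- Leading terms are preserved by linear maps induced by increasing maps of tree monomials. -/
theorem IsLeadingTerm.mapDomain {I I' : Finset ℕ} {m : TreeMonomial ar I → TreeMonomial ar I'}
    (hm : ∀ t t', o.lt I t t' → o.lt I' (m t) (m t')) {f : TreeMonomial ar I →₀ k}
    {t : TreeMonomial ar I} (h : o.IsLeadingTerm f t) :
    o.IsLeadingTerm (f.mapDomain m) (m t) := by
  classical
  have := o.isWellOrder I
  have := o.isWellOrder I'
  have hinj : Function.Injective m := by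
    intro a b hab
    rcases trichotomous_of (o.lt I) a b with hlt | rfl | hlt
    · have := hm _ _ hlt
      rw [hab] at this
      exact absurd this (irrefl _)
    · rfl
    · have := hm _ _ hlt
      rw [hab] at this
      exact absurd this (irrefl _)
  rw [IsLeadingTerm, Finsupp.mapDomain_support_of_injective hinj]
  refine ⟨Finset.mem_image_of_mem m h.1, fun t' ht' hne => ?_⟩
  obtain ⟨r, hr, rfl⟩ := Finset.mem_image.1 ht'
  exact hm _ _ (h.2 r hr fun e => hne (by rw [e]))

variable (o) in
/-- `t` is the leading term of an element of the ideal `N`. -/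
def IsLeadingTermOf (N : (freeShuffle k ar).Ideal) {I : Finset ℕ} (t : TreeMonomial ar I) : Prop :=
  ∃ f : TreeMonomial ar I →₀ k, f ∈ N.carrier I ∧ o.IsLeadingTerm f t

namespace IsLeadingTermOf

variable {N : (freeShuffle k ar).Ideal}

theorem graft_left {J : Finset ℕ} {K : {j // j ∈ J} → Finset ℕ} {I : Finset ℕ}
    {t : TreeMonomial ar J} (ht : o.IsLeadingTermOf N t) (h : Blocks MinLT J K I)
    (s : ∀ j, TreeMonomial ar (K j)) : o.IsLeadingTermOf N (TreeMonomial.graft h t s) := by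
  obtain ⟨f, hf, hl⟩ := ht
  refine ⟨_, N.comp_left h f (fun j => (Finsupp.single (s j) 1 : TreeMonomial ar (K j) →₀ k)) hf,
    ?_⟩
  change o.IsLeadingTerm (freeComp k ar h f fun j => Finsupp.single (s j) 1) _
  rw [freeComp_eq_mapDomain_left]
  exact hl.mapDomain (m := fun t => TreeMonomial.graft h t s) fun t t' hlt =>
    o.graft_lt_left h t t' s hlt

theorem graft_right {J : Finset ℕ} {K : {j // j ∈ J} → Finset ℕ} {I : Finset ℕ}
    {s : ∀ j, TreeMonomial ar (K j)} {j₀ : {j // j ∈ J}} (hs : o.IsLeadingTermOf N (s j₀))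
    (h : Blocks MinLT J K I) (t : TreeMonomial ar J) :
    o.IsLeadingTermOf N (TreeMonomial.graft h t s) := by
  obtain ⟨f, hf, hl⟩ := hs
  have e : Function.update (fun j => (Finsupp.single (s j) 1 : TreeMonomial ar (K j) →₀ k)) j₀ f j₀
      = f := Function.update_self ..
  refine ⟨_, N.comp_right h (Finsupp.single t 1 : TreeMonomial ar J →₀ k)
    (Function.update (fun j => (Finsupp.single (s j) 1 : TreeMonomial ar (K j) →₀ k)) j₀ f) j₀
    ((congrArg (· ∈ N.carrier (K j₀)) e).mpr hf), ?_⟩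
  change o.IsLeadingTerm (freeComp k ar h (Finsupp.single t 1)
    (Function.update (fun j => Finsupp.single (s j) 1) j₀ f)) _
  rw [freeComp_eq_mapDomain_right]
  have := hl.mapDomain (m := fun r => TreeMonomial.graft h t (Function.update s j₀ r))
    fun r r' hlt => o.graft_lt_right h t _ _ j₀ (fun j hj => by simp [hj]) (by simpa using hlt)
  rwa [Function.update_eq_self] at this

end IsLeadingTermOf

end AdmissibleOrder

theorem LTree.blocks_minLT {t : LTree ar} {s : ℕ → LTree ar}
    (hs : StrictMonoOn (fun j => (s j).minLeaf) (t.leaves : Set ℕ))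
    (hd : ∀ j ∈ t.leaves, ∀ j' ∈ t.leaves, j ≠ j' → Disjoint (s j).leaves (s j').leaves) :
    Blocks MinLT t.leaves (fun j => (s j.1).leaves) (t.graft s).leaves where
  nonempty j := leaves_nonempty _
  disjoint j j' h := hd j j.2 j' j'.2 fun e => h (Subtype.ext e)
  mem_iff i := by simp [mem_leaves_graft]
  order j j' h := ⟨_, minLeaf_mem _, fun _ hb => (hs j.2 j'.2 h).trans_le (minLeaf_le hb)⟩

namespace AdmissibleOrder

variable {o : AdmissibleOrder ar} {N : (freeShuffle k ar).Ideal}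

/-- Here `r` is obtained from `d`, up to relabelling, by grafting trees onto its leaves. -/
theorem IsLeadingTermOf.of_isTop {I I' : Finset ℕ} {d : TreeMonomial ar I'} {r : TreeMonomial ar I}
    (hd : o.IsLeadingTermOf N d) {u : LTree ar} (hu : r.1.IsTop u) {σ : ℕ → ℕ}
    (hσ : StrictMonoOn σ (u.leaves : Set ℕ)) (he : u.relabel σ = d.1) :
    o.IsLeadingTermOf N r := by
  obtain ⟨d, hdsh, rfl⟩ := d
  obtain ⟨r, hr, rfl⟩ := r
  dsimp only at hu he
  subst he
  obtain ⟨s, hs, hsh, hmin, hdis⟩ := hu.exists_graft_eq hr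
  have hinv : ∀ j ∈ u.leaves, Function.invFunOn σ (u.leaves : Set ℕ) (σ j) = j := fun j hj =>
    hσ.injOn.leftInvOn_invFunOn hj
  let S : ℕ → LTree ar := fun j => s (Function.invFunOn σ (u.leaves : Set ℕ) j)
  have hS : ∀ j ∈ u.leaves, S (σ j) = s j := fun j hj => by simp only [S, hinv j hj]
  have hlv : ∀ x, x ∈ (u.relabel σ).leaves ↔ ∃ j ∈ u.leaves, σ j = x := fun x => by
    rw [LTree.leaves_relabel, Finset.mem_image]
  have hg : (u.relabel σ).graft S = r := by
    rw [LTree.graft_relabel, ← hs]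
    exact LTree.graft_congr hS
  have hb : Blocks MinLT (u.relabel σ).leaves (fun j => (S j.1).leaves) r.leaves := by
    rw [← hg]
    refine LTree.blocks_minLT ?_ ?_
    · intro x hx y hy hxy
      obtain ⟨j, hj, rfl⟩ := (hlv x).1 hx
      obtain ⟨j', hj', rfl⟩ := (hlv y).1 hy
      simp only [hS j hj, hS j' hj', hmin j hj, hmin j' hj']
      exact (hσ.lt_iff_lt hj hj').1 hxy
    · intro x hx y hy hxy
      obtain ⟨j, hj, rfl⟩ := (hlv x).1 hx
      obtain ⟨j', hj', rfl⟩ := (hlv y).1 hy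
      rw [hS j hj, hS j' hj']
      exact hdis j hj j' hj' fun e => hxy (by rw [e])
  have hSsh : ∀ j ∈ (u.relabel σ).leaves, (S j).IsShuffle := by
    intro x hx
    obtain ⟨j, hj, rfl⟩ := (hlv x).1 hx
    rw [hS j hj]
    exact hsh j hj
  have := hd.graft_left hb fun j => ⟨S j.1, hSsh j.1 j.2, rfl⟩
  have e : TreeMonomial.graft hb ⟨u.relabel σ, hdsh, rfl⟩
      (fun j => ⟨S j.1, hSsh j.1 j.2, rfl⟩) = ⟨r, hr, rfl⟩ :=
    Subtype.ext ((TreeMonomial.graft_val hb _ _ fun _ => rfl).trans hg)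
  rwa [e] at this

/-- Here `t` is obtained by grafting `w` onto one leaf of another tree. -/
theorem IsLeadingTermOf.of_isMaxSubtree {I : Finset ℕ} {t : TreeMonomial ar I} {w : LTree ar}
    (hw : t.1.IsMaxSubtree w)
    (h : ∀ (I' : Finset ℕ) (r : TreeMonomial ar I'), r.1 = w → o.IsLeadingTermOf N r) :
    o.IsLeadingTermOf N t := by
  obtain ⟨t, ht, rfl⟩ := t
  dsimp only at hw
  obtain ⟨u, hu, hg, hmem, hx⟩ := hw.exists_isTop ht
  set s : ℕ → LTree ar := Function.update .leaf w.minLeaf w with hs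
  have hs1 : s w.minLeaf = w := by simp [hs]
  have hs2 : ∀ j, j ≠ w.minLeaf → s j = .leaf j := fun j hj => by simp [hs, hj]
  have hmin : ∀ j, (s j).minLeaf = j := by
    intro j
    by_cases hj : j = w.minLeaf
    · rw [hj, hs1]
    · rw [hs2 j hj, LTree.minLeaf_leaf]
  have hinter : ∀ j, ∀ x ∈ u.leaves, x ∈ (s j).leaves → x = j := by
    intro j x hxu hxs
    by_cases hj : j = w.minLeaf
    · rw [hj, hs1] at hxs
      rw [hj, hx x hxu hxs]
    · simpa [hs2 j hj, LTree.leaves] using hxs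
  have hdis : ∀ j ∈ u.leaves, ∀ j' ∈ u.leaves, j ≠ j' → j ≠ w.minLeaf →
      Disjoint (s j).leaves (s j').leaves := by
    intro j hj j' _ hne hjw
    rw [hs2 j hjw, LTree.leaves, Finset.disjoint_singleton_left]
    exact fun h' => hne (hinter j' j hj h')
  have hb : Blocks MinLT u.leaves (fun j => (s j.1).leaves) t.leaves := by
    rw [← hg]
    refine LTree.blocks_minLT (fun x _ y _ hxy => by simpa only [hmin] using hxy) ?_
    intro j hj j' hj' hne
    by_cases hjw : j = w.minLeaf
    · exact (hdis j' hj' j hj hne.symm (by omega)).symm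
    · exact hdis j hj j' hj' hne hjw
  have hsh : ∀ j, (s j).IsShuffle := by
    intro j
    by_cases hj : j = w.minLeaf
    · rw [hj, hs1]
      exact hw.isShuffle ht
    · rw [hs2 j hj]
      trivial
  have := IsLeadingTermOf.graft_right (o := o) (N := N) (j₀ := ⟨w.minLeaf, hmem⟩)
    (s := fun j : {j // j ∈ u.leaves} => (⟨s j.1, hsh j.1, rfl⟩ : TreeMonomial ar (s j.1).leaves))
    (h _ _ hs1) hb ⟨u, hu.isShuffle ht, rfl⟩
  have e : TreeMonomial.graft hb ⟨u, hu.isShuffle ht, rfl⟩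
      (fun j => ⟨s j.1, hsh j.1, rfl⟩) = ⟨t, ht, rfl⟩ :=
    Subtype.ext ((TreeMonomial.graft_val hb _ _ fun _ => rfl).trans hg)
  rwa [e] at this

/-- The leading terms of the elements of an ideal are closed under passing to multiples. -/
theorem IsLeadingTermOf.of_divides {I I' : Finset ℕ} {d : TreeMonomial ar I'}
    (hd : o.IsLeadingTermOf N d) {t : TreeMonomial ar I} (h : d.1.Divides t.1) :
    o.IsLeadingTermOf N t := by
  obtain ⟨w, u, hw, hu, σ, hσ, he⟩ := h
  refine .of_isMaxSubtree hw ?_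
  rintro I' r rfl
  exact hd.of_isTop hu hσ he

end AdmissibleOrder

theorem ShuffleOperad.subset_idealSpan {P : ShuffleOperad.{u, v} k} (S : ∀ I, Set (P.obj I))
    (I : Finset ℕ) : S I ⊆ (P.idealSpan S).carrier I := fun _ hx =>
  (Submodule.mem_iInf _).2 fun N => N.2 I hx

namespace AdmissibleOrder

variable {o : AdmissibleOrder ar} {N : (freeShuffle k ar).Ideal}
  {G : ∀ I, Set (TreeMonomial ar I →₀ k)}

variable (o N G) in
/-- The class of a normal tree monomial in the quotient by the ideal `N`. -/
noncomputable def normalClass (I : Finset ℕ) (t : {t : TreeMonomial ar I // o.IsNormal G t.1}) :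
    N.quotient.obj I :=
  N.toQuotient (Finsupp.single t.1 1 : TreeMonomial ar I →₀ k)

/-- The projection to the quotient by the ideal `N`. -/
noncomputable def _root_.ShuffleOperad.Ideal.proj (N : (freeShuffle k ar).Ideal) (I : Finset ℕ) :
    (TreeMonomial ar I →₀ k) →ₗ[k] N.quotient.obj I :=
  (N.carrier I).mkQ

theorem _root_.ShuffleOperad.Ideal.proj_eq_zero_iff {I : Finset ℕ} (f : TreeMonomial ar I →₀ k) :
    N.proj I f = 0 ↔ f ∈ N.carrier I :=
  Submodule.Quotient.mk_eq_zero (N.carrier I)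

theorem _root_.Finsupp.map_mem_of_support {α M : Type*} [AddCommGroup M] [Module k M]
    (π : (α →₀ k) →ₗ[k] M) (W : Submodule k M) {f : α →₀ k}
    (h : ∀ a ∈ f.support, π (Finsupp.single a 1) ∈ W) : π f ∈ W := by
  rw [← Finsupp.sum_single f, Finsupp.sum, map_sum]
  refine W.sum_mem fun a ha => ?_
  rw [← mul_one (f a), ← smul_eq_mul, ← Finsupp.smul_single, map_smul]
  exact W.smul_mem _ (h a ha)

namespace IsGroebnerBasis

/-- The leading term of a nontrivial relation between normal tree monomials would not be normal. -/
theorem linearIndependent (hG : o.IsGroebnerBasis N G) (I : Finset ℕ) :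
    LinearIndependent k (o.normalClass N G I) := by
  classical
  rw [linearIndependent_iff]
  intro l hl
  have e : Finsupp.linearCombination k (o.normalClass N G I) l
      = N.proj I (l.mapDomain Subtype.val) := by
    refine DFunLike.congr_fun (f := Finsupp.linearCombination k (o.normalClass N G I))
      (g := N.proj I ∘ₗ Finsupp.lmapDomain k k Subtype.val) (Finsupp.lhom_ext fun t r => ?_) l
    rw [Finsupp.linearCombination_single, LinearMap.comp_apply, Finsupp.lmapDomain_apply,
      Finsupp.mapDomain_single, ← mul_one r, ← smul_eq_mul, ← Finsupp.smul_single, map_smul,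
      smul_eq_mul, mul_one]
    rfl
  rw [e, N.proj_eq_zero_iff] at hl
  by_contra hne
  have hne' : l.mapDomain Subtype.val ≠ 0 := fun h0 =>
    hne (Finsupp.mapDomain_injective Subtype.val_injective (h0.trans Finsupp.mapDomain_zero.symm))
  obtain ⟨t, ht⟩ := o.exists_isLeadingTerm hne'
  obtain ⟨I', g, d, hg, hd, hdiv⟩ := hG.2 I _ t hl ht
  obtain ⟨t', _, rfl⟩ := Finset.mem_image.1 (Finsupp.mapDomain_support ht.1)
  exact t'.2 I' g d hg hd hdiv

/-- A tree monomial that is not normal is the leading term of an element of the ideal, hence modulo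
the ideal a combination of smaller tree monomials. -/
theorem span_eq_top (hG : o.IsGroebnerBasis N G) (I : Finset ℕ) :
    Submodule.span k (Set.range (o.normalClass N G I)) = ⊤ := by
  have key : ∀ t : TreeMonomial ar I,
      N.proj I (Finsupp.single t 1) ∈ Submodule.span k (Set.range (o.normalClass N G I)) := by
    classical
    intro t
    induction t using (o.isWellOrder I).wf.induction with
    | _ t ih =>
      by_cases ht : o.IsNormal G t.1
      · exact Submodule.subset_span ⟨⟨t, ht⟩, rfl⟩
      simp only [IsNormal, not_forall, not_not] at ht
      obtain ⟨I', g, d, hg, hd, hdiv⟩ := ht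
      have hgN : g ∈ N.carrier I' := by
        rw [← hG.1]
        exact ShuffleOperad.subset_idealSpan (P := freeShuffle k ar) G I' hg
      obtain ⟨f, hf, hl⟩ := IsLeadingTermOf.of_divides (o := o) (N := N) ⟨g, hgN, hd⟩ hdiv
      have h1 : N.proj I (f.erase t) ∈ Submodule.span k (Set.range (o.normalClass N G I)) := by
        refine Finsupp.map_mem_of_support _ _ fun a ha => ih a ?_
        rw [Finsupp.support_erase, Finset.mem_erase] at ha
        exact hl.2 a ha.2 ha.1
      have h2 : f t • N.proj I (Finsupp.single t 1) = - N.proj I (f.erase t) := by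
        rw [eq_neg_iff_add_eq_zero, ← map_smul, ← map_add, Finsupp.smul_single, smul_eq_mul,
          mul_one, Finsupp.single_add_erase, N.proj_eq_zero_iff]
        exact hf
      rw [← Submodule.smul_mem_iff _ (Finsupp.mem_support_iff.1 hl.1), h2]
      exact Submodule.neg_mem _ h1
  rw [eq_top_iff]
  rintro x -
  obtain ⟨f, rfl⟩ := Submodule.Quotient.mk_surjective (N.carrier I) x
  exact Finsupp.map_mem_of_support (N.proj I) _ fun t _ => key t

end IsGroebnerBasis

end AdmissibleOrder

end NormalBasis

/-! ### Freeness of the quotient -/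

section Freeness

variable {k : Type u} [Field k] {B : Type v} {ar : B → ℕ+}

theorem BlockOperad.cast_comp {R : Finset ℕ → Finset ℕ → Prop} (Q : BlockOperad.{u, w} R k)
    {J : Finset ℕ} {K : {j // j ∈ J} → Finset ℕ} {I I' : Finset ℕ} (e : I = I')
    (h : Blocks R J K I) (h' : Blocks R J K I') (a : Q.obj J) (c : ∀ j, Q.obj (K j)) :
    cast (congrArg Q.obj e) (Q.comp h a c) = Q.comp h' a c := by
  subst e
  rfl

theorem NSOperad.evalMonomial_of_isPrime (Q : NSOperad.{u, w} k)
    (g : ∀ n, TreeMonomial ar (Finset.range n) → Q.obj (Finset.range n)) {n : ℕ}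
    (t : TreeMonomial ar (Finset.range n)) (ht : t.1.IsPrime) : Q.evalMonomial g t = g n t := by
  -- the factorization with trivial branches
  let F : t.1.PrimeFactorization :=
    { arity := n
      head := t.1
      branch := .leaf
      isPrime_head := ht
      isShuffle_head := t.2.1
      leaves_head := t.2.2
      ascendingOn := LTree.ascendingOn_leaf (σ := id) strictMonoOn_id
      isShuffle_branch := fun _ _ => trivial
      graft_eq := LTree.graft_leaf t.1 }
  have h : Blocks AllLT (Finset.range n) (fun j => {j.1}) (Finset.range n) := by
    have := F.blocks
    rwa [t.2.2] at this
  rw [evalMonomial, Q.evalTree_eq g F]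
  refine (Q.cast_comp t.2.2 F.blocks h _ _).trans (Eq.trans ?_ (Q.comp_unit h (g n t)))
  congr 1
  funext j
  exact Q.evalTree_leaf g j.1

namespace AdmissibleOrder

variable {o : AdmissibleOrder ar} {N : (freeShuffle k ar).Ideal}
  {G : ∀ I, Set (TreeMonomial ar I →₀ k)}

theorem isNormal_leaf (hprime : ∀ (I : Finset ℕ) (g : TreeMonomial ar I →₀ k)
      (t : TreeMonomial ar I), g ∈ G I → o.IsLeadingTerm g t → t.1.IsPrime) (x : ℕ) :
    o.IsNormal G (.leaf x) := by
  rintro I g d hg hd ⟨w, u, hw, hu, σ, _, he⟩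
  have hp := hprime I g d hg hd
  cases hw
  cases hu
  rw [← he] at hp
  exact hp

/-- If the leading terms are prime, a tree monomial is normal if and only if its prime head and its
branches are. -/
theorem isNormal_iff (hprime : ∀ (I : Finset ℕ) (g : TreeMonomial ar I →₀ k)
      (t : TreeMonomial ar I), g ∈ G I → o.IsLeadingTerm g t → t.1.IsPrime) {t : LTree ar}
    (ht : t.IsShuffle) (F : t.PrimeFactorization) :
    o.IsNormal G t ↔ o.IsNormal G F.head ∧ ∀ j ∈ F.head.leaves, o.IsNormal G (F.branch j) := by
  constructor
  · intro h
    refine ⟨fun I g d hg hd hdiv => ?_, fun j hj I g d hg hd hdiv => ?_⟩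
    · exact h I g d hg hd ((F.divides_iff ht (hprime I g d hg hd)).2 (.inl hdiv))
    · exact h I g d hg hd ((F.divides_iff ht (hprime I g d hg hd)).2 (.inr ⟨j, hj, hdiv⟩))
  · rintro ⟨h1, h2⟩ I g d hg hd hdiv
    obtain h | ⟨j, hj, h⟩ := (F.divides_iff ht (hprime I g d hg hd)).1 hdiv
    · exact h1 I g d hg hd h
    · exact h2 j hj I g d hg hd h

theorem isNormal_graft (hprime : ∀ (I : Finset ℕ) (g : TreeMonomial ar I →₀ k)
      (t : TreeMonomial ar I), g ∈ G I → o.IsLeadingTerm g t → t.1.IsPrime) {s : ℕ → LTree ar} :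
    ∀ {t : LTree ar}, t.IsShuffle → o.IsNormal G t → LTree.AscendingOn s t.leaves →
      (∀ j ∈ t.leaves, (s j).IsShuffle) → (∀ j ∈ t.leaves, o.IsNormal G (s j)) →
      o.IsNormal G (t.graft s) := by
  intro t
  generalize hn : t.size = n
  induction n using Nat.strong_induction_on generalizing t with
  | _ n ih =>
    intro ht htn hs hsh hsn
    cases t with
    | leaf x => exact hsn x (by simp [LTree.leaves])
    | node b ch =>
      obtain ⟨F⟩ := LTree.PrimeFactorization.nonempty ht
      rw [isNormal_iff hprime ht F] at htn
      refine (isNormal_iff hprime (hs.isShuffle_graft ht hsh) (F.graft hs hsh)).2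
        ⟨htn.1, fun j hj => ?_⟩
      have hsub := F.leaves_branch_subset hj
      exact ih _ (hn ▸ F.size_branch_lt hj) rfl (F.isShuffle_branch j hj) (htn.2 j hj)
        (hs.mono hsub) (fun i hi => hsh i (hsub hi)) fun i hi => hsn i (hsub hi)

theorem isNormal_monomial_graft (hprime : ∀ (I : Finset ℕ) (g : TreeMonomial ar I →₀ k)
      (t : TreeMonomial ar I), g ∈ G I → o.IsLeadingTerm g t → t.1.IsPrime)
    {J I : Finset ℕ} {K : {j // j ∈ J} → Finset ℕ} (h : Blocks AllLT J K I)
    {t : TreeMonomial ar J} (ht : o.IsNormal G t.1) {s : ∀ j, TreeMonomial ar (K j)}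
    (hs : ∀ j, o.IsNormal G (s j).1) : o.IsNormal G (TreeMonomial.graft h.minLT t s).1 := by
  obtain ⟨S, hS⟩ := TreeMonomial.exists_extend s
  have hasc := TreeMonomial.ascendingOn h s hS
  rw [TreeMonomial.graft_val h.minLT t s hS]
  rw [← t.2.2] at hasc
  have hmem : ∀ j ∈ t.1.leaves, j ∈ J := fun j hj => t.2.2 ▸ hj
  refine isNormal_graft hprime t.2.1 ht hasc (fun j hj => ?_) fun j hj => ?_
  · exact hS ⟨j, hmem j hj⟩ ▸ (s ⟨j, hmem j hj⟩).2.1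
  · exact hS ⟨j, hmem j hj⟩ ▸ hs ⟨j, hmem j hj⟩

/-- The basis of the quotient operad that consists of the classes of normal tree monomials. -/
noncomputable def IsGroebnerBasis.basis (hG : o.IsGroebnerBasis N G) (I : Finset ℕ) :
    Module.Basis {t : TreeMonomial ar I // o.IsNormal G t.1} k (N.quotient.obj I) :=
  .mk (hG.linearIndependent I) (hG.span_eq_top I).ge

theorem IsGroebnerBasis.basis_apply (hG : o.IsGroebnerBasis N G) (I : Finset ℕ)
    (t : {t : TreeMonomial ar I // o.IsNormal G t.1}) :
    hG.basis I t = N.toQuotient (Finsupp.single t.1 1 : TreeMonomial ar I →₀ k) :=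
  Module.Basis.mk_apply _ _ t

end AdmissibleOrder

theorem ShuffleOperad.Ideal.quotient_comp_single (N : (freeShuffle k ar).Ideal)
    {J I : Finset ℕ} {K : {j // j ∈ J} → Finset ℕ} (h : Blocks MinLT J K I)
    (t : TreeMonomial ar J) (s : ∀ j, TreeMonomial ar (K j)) :
    N.quotient.comp h (N.toQuotient (Finsupp.single t 1 : TreeMonomial ar J →₀ k))
        (fun j => N.toQuotient (Finsupp.single (s j) 1 : TreeMonomial ar (K j) →₀ k))
      = N.toQuotient (Finsupp.single (TreeMonomial.graft h t s) 1 : TreeMonomial ar I →₀ k) := by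
  refine (N.quotComp_mk h (Finsupp.single t 1 : TreeMonomial ar J →₀ k)
    (fun j => (Finsupp.single (s j) 1 : TreeMonomial ar (K j) →₀ k))).trans ?_
  exact congrArg _ (freeComp_single k ar h t s)

namespace AdmissibleOrder.IsGroebnerBasis

variable {o : AdmissibleOrder ar} {N : (freeShuffle k ar).Ideal}
  {G : ∀ I, Set (TreeMonomial ar I →₀ k)}

/-- The morphism of nonsymmetric operads that sends the class of a normal tree monomial to its value
under `NSOperad.evalMonomial`. It is compatible with compositions since nonsymmetric compositions of
normal tree monomials are normal. -/
noncomputable def evalHom (hG : o.IsGroebnerBasis N G)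
    (hprime : ∀ (I : Finset ℕ) (g : TreeMonomial ar I →₀ k)
      (t : TreeMonomial ar I), g ∈ G I → o.IsLeadingTerm g t → t.1.IsPrime) (Q : NSOperad.{u, w} k)
    (g : ∀ n, TreeMonomial ar (Finset.range n) → Q.obj (Finset.range n)) :
    N.quotient.toNS.Hom Q where
  map I := (hG.basis I).constr k fun t => Q.evalMonomial g t.1
  map_unit x := by
    have := (hG.basis {x}).constr_basis k (fun t => Q.evalMonomial g t.1)
      ⟨TreeMonomial.unit x, isNormal_leaf hprime x⟩
    rw [hG.basis_apply, Q.evalMonomial_unit] at this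
    exact this
  map_comp {J K I} h a c := by
    classical
    set φ : ∀ I, N.quotient.obj I →ₗ[k] Q.obj I :=
      fun I => (hG.basis I).constr k fun t => Q.evalMonomial g t.1 with hφ
    have hφb : ∀ I t, φ I (hG.basis I t) = Q.evalMonomial g t.1 := fun I t =>
      (hG.basis I).constr_basis k _ t
    change φ I (N.quotient.comp h.minLT a c) = Q.comp h (φ J a) fun j => φ (K j) (c j)
    revert c
    suffices H : ∀ a, (φ I).compMultilinearMap (N.quotient.comp h.minLT a)
        = (Q.comp h (φ J a)).compLinearMap fun j => φ (K j) from
      fun c => DFunLike.congr_fun (H a) c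
    intro a
    refine Module.Basis.ext_multilinear (fun j => hG.basis (K j)) fun s => ?_
    simp only [LinearMap.compMultilinearMap_apply, MultilinearMap.compLinearMap_apply, hφb]
    induction (hG.basis J).mem_span a using Submodule.span_induction with
    | zero => simp
    | add x y _ _ hx hy => simp only [map_add, _root_.add_apply, hx, hy]
    | smul r x _ hx => simp only [map_smul, _root_.smul_apply, hx]
    | mem x hx =>
      obtain ⟨t, rfl⟩ := hx
      rw [hφb, ← Q.evalMonomial_graft g h t.1 fun j => (s j).1]
      simp only [hG.basis_apply]
      rw [N.quotient_comp_single h.minLT,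
        ← hφb I ⟨_, isNormal_monomial_graft hprime h t.2 fun j => (s j).2⟩, hG.basis_apply]

/-- The classes of prime normal tree monomials generate the quotient as a nonsymmetric operad. -/
theorem hom_ext (hG : o.IsGroebnerBasis N G)
    (hprime : ∀ (I : Finset ℕ) (g : TreeMonomial ar I →₀ k)
      (t : TreeMonomial ar I), g ∈ G I → o.IsLeadingTerm g t → t.1.IsPrime) {Q : NSOperad.{u, w} k}
    {φ ψ : N.quotient.toNS.Hom Q} (h : ∀ p : PrimeNormalMonomial o G,
      φ.map _ (N.toQuotient (Finsupp.single p.tree 1 : TreeMonomial ar (Finset.range p.arity) →₀ k))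
        = ψ.map _ (N.toQuotient
          (Finsupp.single p.tree 1 : TreeMonomial ar (Finset.range p.arity) →₀ k))) :
    φ = ψ := by
  have key : ∀ (t : LTree ar) (ht : t.IsShuffle), o.IsNormal G t →
      φ.map t.leaves (N.toQuotient
          (Finsupp.single ⟨t, ht, rfl⟩ 1 : TreeMonomial ar t.leaves →₀ k))
        = ψ.map t.leaves (N.toQuotient
          (Finsupp.single ⟨t, ht, rfl⟩ 1 : TreeMonomial ar t.leaves →₀ k)) := by
    intro t
    generalize hn : t.size = n
    induction n using Nat.strong_induction_on generalizing t with
    | _ n ih =>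
      intro ht htn
      cases t with
      | leaf x => exact (φ.map_unit x).trans (ψ.map_unit x).symm
      | node b ch =>
        obtain ⟨F⟩ := LTree.PrimeFactorization.nonempty ht
        rw [isNormal_iff hprime ht F] at htn
        have hmem : ∀ j : {j // j ∈ Finset.range F.arity}, j.1 ∈ F.head.leaves := fun j =>
          F.mem_head.2 (Finset.mem_range.1 j.2)
        let p : PrimeNormalMonomial o G :=
          ⟨F.arity, ⟨F.head, F.isShuffle_head, F.leaves_head⟩, F.isPrime_head, htn.1⟩
        let s : ∀ j : {j // j ∈ Finset.range F.arity}, TreeMonomial ar (F.branch j.1).leaves :=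
          fun j => ⟨F.branch j.1, F.isShuffle_branch j.1 (hmem j), rfl⟩
        have e : TreeMonomial.graft F.blocks.minLT p.tree s = ⟨.node b ch, ht, rfl⟩ :=
          Subtype.ext
            ((TreeMonomial.graft_val F.blocks.minLT p.tree s fun _ => rfl).trans F.graft_eq)
        rw [← e, ← N.quotient_comp_single F.blocks.minLT]
        refine (φ.map_comp F.blocks _ _).trans (Eq.trans ?_ (ψ.map_comp F.blocks _ _).symm)
        rw [h p]
        congr 1
        funext j
        exact ih _ (hn ▸ F.size_branch_lt (hmem j)) (F.branch j.1) rfl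
          (F.isShuffle_branch j.1 (hmem j)) (htn.2 j.1 (hmem j))
  have hmap : φ.map = ψ.map := by
    funext I
    refine (hG.basis I).ext fun t => ?_
    obtain ⟨⟨t, ht, rfl⟩, htn⟩ := t
    rw [hG.basis_apply]
    exact key t ht htn
  cases φ
  cases ψ
  cases hmap
  rfl

end AdmissibleOrder.IsGroebnerBasis

end Freeness

theorem theorem3p1 {k : Type u} [Field k] {B : Type v} (ar : B → ℕ+)
    (R : ∀ I, Set ((freeShuffle k ar).obj I)) (o : AdmissibleOrder ar)
    (G : ∀ I, Set (TreeMonomial ar I →₀ k))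
    (hG : o.IsGroebnerBasis ((freeShuffle k ar).idealSpan R) G)
    (hprime : ∀ (I : Finset ℕ) (g : TreeMonomial ar I →₀ k) (t : TreeMonomial ar I),
      g ∈ G I → o.IsLeadingTerm g t → t.1.IsPrime) :
    NSOperad.IsFreelyGenerated.{u, max u v, w}
      ((freeShuffle k ar).idealSpan R).quotient.toNS
      (fun p : PrimeNormalMonomial o G => p.arity)
      (fun p => ((freeShuffle k ar).idealSpan R).toQuotient
        (Finsupp.single p.tree (1 : k) : TreeMonomial ar (Finset.range p.arity) →₀ k)) := by
  classical
  intro Q f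
  let g : ∀ n, TreeMonomial ar (Finset.range n) → Q.obj (Finset.range n) := fun n t =>
    if h : t.1.IsPrime ∧ o.IsNormal G t.1 then f ⟨n, t, h.1, h.2⟩ else 0
  have hφ : ∀ p : PrimeNormalMonomial o G, (hG.evalHom hprime Q g).map _
      (((freeShuffle k ar).idealSpan R).toQuotient
        (Finsupp.single p.tree (1 : k) : TreeMonomial ar (Finset.range p.arity) →₀ k)) = f p := by
    intro p
    have hg : g p.arity p.tree = f p := dif_pos ⟨p.isPrime, p.isNormal⟩
    rw [← hg, ← Q.evalMonomial_of_isPrime g p.tree p.isPrime]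
    have := (hG.basis _).constr_basis k (fun t => Q.evalMonomial g t.1) ⟨p.tree, p.isNormal⟩
    rw [hG.basis_apply] at this
    exact this
  exact ⟨hG.evalHom hprime Q g, hφ, fun ψ hψ => hG.hom_ext hprime fun p => (hψ p).trans (hφ p).symm⟩
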